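/- **Corollary (Information-Theoretic Lower Bound for Phase Retrieval).** Let $\mathbf{X}$ be uniformly distributed on the sphere of radius $\sqrt d$ in $\mathbb{C}^d$, and let $\mathbf{A}_1,\dots,\mathbf{A}_n$ be i.i.d. with distribution ${\sf CN}(\mathbf{0}_d,\mathbf{I}_d/d)$ (circularly-symmetric complex normal), independent of $\mathbf{X}$. Given $\mathbf{X}$ and $\mathbf{A}=(\mathbf{A}_1,\dots,\mathbf{A}_n)$, let the measurements $Y_1,\dots,Y_n\in\mathbb{R}$ be independent, where for a noise level $\sigma>0$ the variable $Y_i$ has density $$p_{\rm PR}\bigl(y\mid |\langle \mathbf{X},\mathbf{A}_i\rangle|\bigr)=\frac{1}{\sigma\sqrt{2\pi}}\exp\Bigl(-\frac{(y-|\langle \mathbf{X},\mathbf{A}_i\rangle|^2)^2}{2\sigma^2}\Bigr).$$ Let $\mathbf{Y}=(Y_1,\dots,Y_n)$ and define the matrix minimum mean square error $${\sf MMSE}_{\rm PR}(n,d,\sigma)=\frac{1}{d^2}\,\mathbb{E}\Bigl\{\bigl\|\mathbf{X}\mathbf{X}^*-\mathbb{E}\{\mathbf{X}\mathbf{X}^*\mid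 \mathbf{Y},\mathbf{A}\}\bigr\|_F^2\Bigr\}.$$ Let $0<\delta<1$ and let $d=d_n$ be such that $n/d_n\to\delta$ as $n\to\infty$. Then the limit $\lim_{n\to\infty}{\sf MMSE}_{\rm PR}(n,d_n,\sigma)$ exists for every $\sigma>0$, and $$\lim_{\sigma\to 0^+}\ \lim_{n\to\infty}{\sf MMSE}_{\rm PR}(n,d_n,\sigma)=1.$$ -/

import Mathlib

open MeasureTheory ProbabilityTheory Filter Topology

noncomputable section

namespace PhaseRetrieval

/-- The signal space `ℂ^d` with its Euclidean norm. -/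
abbrev Sig (d : ℕ) : Type := EuclideanSpace ℂ (Fin d)

/-- The uniform distribution on the complex sphere of radius `√d` in `ℂ^d`: the normalized
surface measure of the unit sphere, rescaled by `√d`. -/
def unifSphere (d : ℕ) : Measure (Sig d) :=
  Measure.map (fun u : Metric.sphere (0 : Sig d) 1 => Real.sqrt (d : ℝ) • (u : Sig d))
    (((volume : Measure (Sig d)).toSphere Set.univ)⁻¹ • (volume : Measure (Sig d)).toSphere)

/-- The scalar circularly-symmetric complex normal distribution `CN(0, v)`: real and imaginary
parts are independent real centered Gaussians, each of variance `v / 2`. -/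
def complexNormal (v : NNReal) : Measure ℂ :=
  Measure.map (fun p : ℝ × ℝ => (⟨p.1, p.2⟩ : ℂ))
    ((gaussianReal 0 (v / 2)).prod (gaussianReal 0 (v / 2)))

/-- The distribution `CN(0, I_d / d)` of a sensing vector: independent `CN(0, 1 / d)` entries. -/
def sensingLaw (d : ℕ) : Measure (Sig d) :=
  Measure.map (WithLp.toLp 2) (Measure.pi fun _ : Fin d => complexNormal (1 / (d : NNReal)))

/-- The conditional density `p(y ∣ r)` of a measurement given that the modulus of the scalar
product of the signal and the sensing vector is `r`. -/
def pPR (σ y r : ℝ) : ℝ :=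
  1 / (σ * Real.sqrt (2 * Real.pi)) * Real.exp (-(y - r ^ 2) ^ 2 / (2 * σ ^ 2))

/-- The joint distribution of signal, sensing vectors and measurements `(x, a, y)`: the signal
is uniform on the sphere, the `n` sensing vectors are i.i.d. and independent of the signal, and
given these the measurements are independent, `y i` having density `p(· ∣ |⟨x, a i⟩|)`. -/
def jointLaw (d n : ℕ) (σ : ℝ) : Measure (Sig d × (Fin n → Sig d) × (Fin n → ℝ)) :=
  ((unifSphere d).prod ((Measure.pi fun _ : Fin n => sensingLaw d).prod volume)).withDensity
    fun ω => ENNReal.ofReal (∏ i : Fin n, pPR σ (ω.2.2 i) ‖inner ℂ (ω.2.1 i) ω.1‖)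

/-- The information available to the estimator: the σ-algebra generated by the sensing vectors
and the measurements. -/
@[reducible] def observed (d n : ℕ) : MeasurableSpace (Sig d × (Fin n → Sig d) × (Fin n → ℝ)) :=
  MeasurableSpace.comap (fun ω => ω.2) inferInstance

/-- The random matrix `X X^*`. -/
def outer {d n : ℕ} (ω : Sig d × (Fin n → Sig d) × (Fin n → ℝ)) : Matrix (Fin d) (Fin d) ℂ :=
  Matrix.vecMulVec (fun i => ω.1 i) (star fun j => ω.1 j)

/-- The conditional expectation `E[X X^* ∣ Y, A]`, entry by entry. -/
def posteriorMean (d n : ℕ) (σ : ℝ) (ω : Sig d × (Fin n → Sig d) × (Fin n → ℝ)) :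
    Matrix (Fin d) (Fin d) ℂ :=
  Matrix.of fun i j => ((jointLaw d n σ)[fun ω' => outer ω' i j | observed d n]) ω

/-- The squared Frobenius norm of a complex matrix. -/
def frobeniusSq {d : ℕ} (M : Matrix (Fin d) (Fin d) ℂ) : ℝ := ∑ i, ∑ j, ‖M i j‖ ^ 2

/-- The matrix minimum mean square error `d⁻² E ‖X X^* - E[X X^* ∣ Y, A]‖_F²`. -/
def mmsePR (d n : ℕ) (σ : ℝ) : ℝ :=
  1 / (d : ℝ) ^ 2 * ∫ ω, frobeniusSq (outer ω - posteriorMean d n σ ω) ∂(jointLaw d n σ)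

end PhaseRetrieval

end

/-!
Why the limit is `1` for every noise level.  The error never exceeds `1`, the error of the zero
estimator, so only the lower bound `one_le_mmsePR_add` needs an argument, and it is a second moment
computation against a null model in which the measurements ignore the signal.

Let `w x o` be the likelihood of the signal `x` given the observations `o`, and let `q` be the
density of `o` when every scalar product of signal and sensing vector is replaced by an independent
standard complex normal.  The optimal error is one minus the mean squared overlap of two replicas
drawn from the posterior, whose density has the denominator `∫ w x o dx`.  Where this
denominator is at least `ε q o` it is replaced by `ε q o`; the remaining observations have
probability at most `ε`.  This gives (`sq_norm_le_mse_add`)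

  `1 ≤ MMSE + ε + ε⁻¹ E[m Φ(x, x')ⁿ]`,

where `x, x'` are independent and uniform on the sphere, `m = |⟨x, x'⟩|² / d²`, and `Φ(x, x')` is
the second moment under the null model of the likelihood ratios at `x` and `x'` for one measurement.

The key estimate is `Φ ≤ 1 / (1 - m)`, whatever the noise (`lintegral_correlated_pair_le`).  The
scalar products of a sensing vector with `x` and `x'` form a pair of complex normals of correlation
`√m`, and the channel only sees their moduli `u`, `v`, so the density of the pair may be averaged
over phases.  The average is at most the mean of its values at `(u, u)` and `(v, v)`; since the
kernel integrated against it has mean one in each variable, only the diagonal remains, and there the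
integral is the mean of the Poisson kernel, `1 / (1 - m)`.

Finally `m` has the Beta distribution with parameters `1` and `d - 1`
(`lintegral_overlap_unifSphere`), so `E[m (1 - m)⁻ⁿ] = (d - 1) / ((d - n) (d - n - 1))`.  For
`n / d → δ < 1` this tends to zero, and `ε` is taken to be its square root.
-/

open scoped ENNReal NNReal

noncomputable section

namespace PhaseRetrieval

/-! ### Complex normal vectors -/

lemma measurable_complex_mk : Measurable (fun p : ℝ × ℝ => (⟨p.1, p.2⟩ : ℂ)) :=
  Complex.measurableEquivRealProd.symm.measurable

instance isProbabilityMeasure_complexNormal (v : ℝ≥0) :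
    IsProbabilityMeasure (complexNormal v) :=
  Measure.isProbabilityMeasure_map measurable_complex_mk.aemeasurable

instance isProbabilityMeasure_sensingLaw (d : ℕ) : IsProbabilityMeasure (sensingLaw d) :=
  Measure.isProbabilityMeasure_map (by fun_prop)

lemma complexNormal_one_eq_withDensity :
    complexNormal 1 =
      volume.withDensity fun z : ℂ => ENNReal.ofReal (Real.pi⁻¹ * Real.exp (-‖z‖ ^ 2)) := by
  have hmp : MeasurePreserving (fun p : ℝ × ℝ => (⟨p.1, p.2⟩ : ℂ)) :=
    Complex.volume_preserving_equiv_real_prod.symm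
  have hv : (1 / 2 : ℝ≥0) ≠ 0 := by norm_num
  rw [complexNormal, gaussianReal_of_var_ne_zero _ hv,
    prod_withDensity (measurable_gaussianPDF _ _) (measurable_gaussianPDF _ _)]
  ext s hs
  rw [Measure.map_apply measurable_complex_mk hs,
    withDensity_apply _ (measurable_complex_mk hs), withDensity_apply _ hs,
    ← hmp.setLIntegral_comp_preimage hs (by fun_prop), Measure.volume_eq_prod]
  refine lintegral_congr fun p => ?_
  rw [gaussianPDF, gaussianPDF, ← ENNReal.ofReal_mul (gaussianPDFReal_nonneg _ _ _)]
  congr 1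
  rw [gaussianPDFReal, gaussianPDFReal, mul_mul_mul_comm, ← Real.exp_add, Complex.sq_norm,
    Complex.normSq_apply]
  have h2 : (2 * Real.pi * ((1 / 2 : ℝ≥0) : ℝ)) = Real.pi := by push_cast; ring
  rw [h2, ← mul_inv, Real.mul_self_sqrt Real.pi_pos.le]
  push_cast
  congr 2
  ring

lemma lintegral_complexNormal_one {f : ℂ → ℝ≥0∞} (hf : Measurable f) :
    ∫⁻ z, f z ∂(complexNormal 1) =
      ∫⁻ z, ENNReal.ofReal (Real.pi⁻¹ * Real.exp (-‖z‖ ^ 2)) * f z := by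
  rw [complexNormal_one_eq_withDensity, lintegral_withDensity_eq_lintegral_mul _ (by fun_prop) hf]
  rfl

lemma charFun_complexNormal (v : ℝ≥0) (t : ℂ) :
    charFun (complexNormal v) t = Complex.exp (-(v * ‖t‖ ^ 2 / 4 : ℝ)) := by
  rw [charFun, complexNormal, integral_map measurable_complex_mk.aemeasurable
    (by fun_prop)]
  have h : ∀ p : ℝ × ℝ, Complex.exp ((inner ℝ (⟨p.1, p.2⟩ : ℂ) t : ℝ) * Complex.I) =
      Complex.exp (t.re * p.1 * Complex.I) * Complex.exp (t.im * p.2 * Complex.I) := by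
    intro p
    rw [← Complex.exp_add]
    congr 1
    simp [Complex.inner]
    ring
  simp_rw [h]
  rw [integral_prod_mul (fun x : ℝ => Complex.exp (t.re * x * Complex.I))
    (fun x : ℝ => Complex.exp (t.im * x * Complex.I)), ← charFun_apply_real,
    ← charFun_apply_real, charFun_gaussianReal, charFun_gaussianReal, ← Complex.exp_add,
    Complex.sq_norm, Complex.normSq_apply]
  congr 1
  push_cast
  ring

lemma charFun_sensingLaw (d : ℕ) (t : Sig d) :
    charFun (sensingLaw d) t = Complex.exp (-(‖t‖ ^ 2 / (4 * d) : ℝ)) := by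
  rw [sensingLaw, charFun_pi]
  simp_rw [charFun_complexNormal, ← Complex.exp_sum, EuclideanSpace.norm_sq_eq]
  congr 1
  push_cast
  rw [Finset.sum_neg_distrib, Finset.sum_div]
  congr 1
  refine Finset.sum_congr rfl fun i _ => ?_
  simp
  ring

/-- Two linear statistics of a sensing vector are jointly Gaussian; they are represented as
`(g, c g + √(1 - |c|²) g')` for independent standard complex normals `g, g'`. -/
lemma map_inner_sensingLaw {d : ℕ} (hd : 0 < d) {x x' : Sig d} (hx : ‖x‖ ^ 2 = d)
    (hx' : ‖x'‖ ^ 2 = d) {c : ℂ} (hc : inner ℂ x x' = d * c) {s : ℝ} (hs : ‖c‖ ^ 2 + s ^ 2 = 1) :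
    (sensingLaw d).map (fun a => ((inner ℂ a x : ℂ), (inner ℂ a x' : ℂ))) =
      ((complexNormal 1).prod (complexNormal 1)).map
        (fun p : ℂ × ℂ => (p.1, c * p.1 + s * p.2)) := by
  have hm1 : Measurable (fun a : Sig d => ((inner ℂ a x : ℂ), (inner ℂ a x' : ℂ))) := by fun_prop
  have hm2 : Measurable (fun p : ℂ × ℂ => (p.1, c * p.1 + s * p.2)) := by fun_prop
  have hlp : Measurable (WithLp.toLp 2 : ℂ × ℂ → WithLp 2 (ℂ × ℂ)) := by fun_prop
  refine (MeasurableEquiv.toLp 2 (ℂ × ℂ)).map_measurableEquiv_injective ?_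
  simp only [MeasurableEquiv.coe_toLp]
  rw [Measure.map_map hlp hm1, Measure.map_map hlp hm2]
  have : IsProbabilityMeasure ((sensingLaw d).map
      (WithLp.toLp 2 ∘ fun a => ((inner ℂ a x : ℂ), (inner ℂ a x' : ℂ)))) :=
    Measure.isProbabilityMeasure_map (hlp.comp hm1).aemeasurable
  have : IsProbabilityMeasure (((complexNormal 1).prod (complexNormal 1)).map
      (WithLp.toLp 2 ∘ fun p : ℂ × ℂ => (p.1, c * p.1 + s * p.2))) :=
    Measure.isProbabilityMeasure_map (hlp.comp hm2).aemeasurable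
  refine Measure.ext_of_charFun (funext fun t => ?_)
  rw [charFun, charFun, integral_map (hlp.comp hm1).aemeasurable (by fun_prop),
    integral_map (hlp.comp hm2).aemeasurable (by fun_prop)]
  have e1 : ∀ a : Sig d, inner ℝ (WithLp.toLp 2 ((inner ℂ a x : ℂ), (inner ℂ a x' : ℂ))) t =
      inner ℝ a ((starRingEnd ℂ t.ofLp.1) • x + (starRingEnd ℂ t.ofLp.2) • x') := by
    intro a
    have h : ∀ b : Sig d, inner ℝ a b = (inner ℂ a b).re := by
      intro b; simp [PiLp.inner_apply]
    rw [h, inner_add_right, inner_smul_right, inner_smul_right]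
    have hre : ∀ b : Sig d, (inner ℂ b a).re = (inner ℂ a b).re := fun b =>
      inner_re_symm (𝕜 := ℂ) b a
    have him : ∀ b : Sig d, (inner ℂ b a).im = -(inner ℂ a b).im := fun b =>
      inner_im_symm (𝕜 := ℂ) b a
    simp [WithLp.prod_inner_apply, Complex.inner, hre, him]
  have e2 : ∀ p : ℂ × ℂ, Complex.exp
      ((inner ℝ (WithLp.toLp 2 (p.1, c * p.1 + s * p.2)) t : ℝ) * Complex.I) =
      Complex.exp ((inner ℝ p.1 (t.ofLp.1 + starRingEnd ℂ c * t.ofLp.2) : ℝ) * Complex.I) *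
      Complex.exp ((inner ℝ p.2 (s * t.ofLp.2) : ℝ) * Complex.I) := by
    intro p
    rw [← Complex.exp_add, ← add_mul, ← Complex.ofReal_add]
    congr 3
    simp [WithLp.prod_inner_apply, Complex.inner]
    ring
  simp only [Function.comp_apply, e1, e2]
  rw [integral_prod_mul
    (fun y : ℂ => Complex.exp ((inner ℝ y (t.ofLp.1 + starRingEnd ℂ c * t.ofLp.2) : ℝ) * Complex.I))
    (fun y : ℂ => Complex.exp ((inner ℝ y (s * t.ofLp.2) : ℝ) * Complex.I))]
  rw [← charFun, ← charFun, ← charFun, charFun_sensingLaw, charFun_complexNormal,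
    charFun_complexNormal, ← Complex.exp_add]
  rw [← neg_add_rev, Complex.exp_eq_exp_iff_exists_int]
  refine ⟨0, ?_⟩
  rw [Int.cast_zero, zero_mul, add_zero, ← Complex.ofReal_add]
  congr 2
  have hd' : (d : ℝ) ≠ 0 := by positivity
  rw [@norm_add_sq ℂ, norm_smul, norm_smul, mul_pow, mul_pow, hx, hx', inner_smul_left,
    inner_smul_right, hc]
  set t1 := t.ofLp.1
  set t2 := t.ofLp.2
  have h1 : ‖t1 + starRingEnd ℂ c * t2‖ ^ 2 =
      ‖t1‖ ^ 2 + ‖c‖ ^ 2 * ‖t2‖ ^ 2 + 2 * (t1 * (starRingEnd ℂ t2 * c)).re := by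
    simp only [Complex.sq_norm, Complex.normSq_apply]
    simp
    ring
  have h2 : ‖(s : ℂ) * t2‖ ^ 2 = s ^ 2 * ‖t2‖ ^ 2 := by
    rw [norm_mul, mul_pow, Complex.norm_real, Real.norm_eq_abs, sq_abs]
  have h3 : ((starRingEnd ℂ (starRingEnd ℂ t1)) * (starRingEnd ℂ t2 * (d * c))).re =
      d * (t1 * (starRingEnd ℂ t2 * c)).re := by
    rw [Complex.conj_conj, ← Complex.re_ofReal_mul]
    congr 1; push_cast; ring
  rw [h1, h2]
  simp only [RCLike.re_eq_complex_re, h3, RCLike.norm_conj]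
  field_simp
  push_cast
  linear_combination (-‖t2‖ ^ 2) * hs

/-! ### The density of a correlated pair of complex normals -/

/-- The density, with respect to two independent standard complex normals, of the law of
`(g, c g + √(1 - |c|²) g')`. -/
def corrDensity (c g g' : ℂ) : ℝ :=
  (1 - ‖c‖ ^ 2)⁻¹ * Real.exp (-(‖c‖ ^ 2 * ‖g‖ ^ 2 + ‖c‖ ^ 2 * ‖g'‖ ^ 2 -
    2 * (starRingEnd ℂ (c * g) * g').re) / (1 - ‖c‖ ^ 2))

/-- The value of `corrDensity` at a correlation of modulus `r` and points of moduli `u`, `v`, as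
a function of the angle `θ` between the correlated points. -/
def phaseDensity (r u v θ : ℝ) : ℝ :=
  (1 - r ^ 2)⁻¹ * Real.exp (-(r ^ 2 * u ^ 2 + r ^ 2 * v ^ 2 -
    2 * (r * u * v * Real.cos θ)) / (1 - r ^ 2))

lemma lintegral_add_smul_complex (f : ℂ → ℝ≥0∞) (hf : Measurable f) (b : ℂ) {s : ℝ} (hs : 0 < s) :
    ∫⁻ w, f w = ENNReal.ofReal (s ^ 2) * ∫⁻ z, f (b + s * z) := by
  have h := Measure.map_addHaar_smul (volume : Measure ℂ) hs.ne'
  have h2 : ∫⁻ z, f (b + s * z) = ∫⁻ w, f (b + w) ∂(volume.map (s • · : ℂ → ℂ)) := by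
    rw [lintegral_map (by fun_prop) (by fun_prop)]
    simp
  rw [h2, h, lintegral_smul_measure, lintegral_add_left_eq_self, smul_eq_mul, ← mul_assoc,
    ← ENNReal.ofReal_mul (by positivity), Complex.finrank_real_complex,
    abs_of_pos (by positivity), mul_inv_cancel₀ (by positivity), ENNReal.ofReal_one, one_mul]

lemma lintegral_correlated {f : ℂ → ℝ≥0∞} (hf : Measurable f) {c : ℂ} {s : ℝ} (hs : 0 < s)
    (hcs : ‖c‖ ^ 2 + s ^ 2 = 1) (g : ℂ) :
    ∫⁻ z, f (c * g + s * z) ∂(complexNormal 1) =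
      ∫⁻ w, f w * ENNReal.ofReal (corrDensity c g w) ∂(complexNormal 1) := by
  have hm : Measurable fun w => ENNReal.ofReal (corrDensity c g w) := by
    unfold corrDensity; fun_prop
  rw [lintegral_complexNormal_one (by fun_prop), lintegral_complexNormal_one
    (f := fun w => f w * ENNReal.ofReal (corrDensity c g w)) (hf.mul hm),
    lintegral_add_smul_complex (fun w => ENNReal.ofReal (Real.pi⁻¹ * Real.exp (-‖w‖ ^ 2)) *
      (f w * ENNReal.ofReal (corrDensity c g w))) (by fun_prop) (c * g) hs,
    ← lintegral_const_mul _ (by unfold corrDensity; fun_prop)]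
  refine lintegral_congr fun z => ?_
  rw [mul_left_comm (ENNReal.ofReal (Real.pi⁻¹ * _)), mul_left_comm (ENNReal.ofReal (s ^ 2)),
    mul_comm _ (f _), ← ENNReal.ofReal_mul (by positivity), ← ENNReal.ofReal_mul (by positivity)]
  congr 2
  have h1 : 1 - ‖c‖ ^ 2 = s ^ 2 := by linarith
  rw [corrDensity, h1]
  have h2 : ∀ A B : ℝ, s ^ 2 * (Real.pi⁻¹ * Real.exp A * ((s ^ 2)⁻¹ * Real.exp B)) =
      Real.pi⁻¹ * Real.exp (A + B) := by
    intro A B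
    rw [Real.exp_add]
    field_simp
  rw [h2]
  congr 2
  have h3 : ‖c * g + s * z‖ ^ 2 =
      ‖c‖ ^ 2 * ‖g‖ ^ 2 + s ^ 2 * ‖z‖ ^ 2 + 2 * (starRingEnd ℂ (c * g) * (s * z)).re := by
    simp only [Complex.sq_norm, Complex.normSq_apply]
    simp
    ring
  have h4 : (starRingEnd ℂ (c * g) * (c * g + s * z)).re =
      ‖c‖ ^ 2 * ‖g‖ ^ 2 + (starRingEnd ℂ (c * g) * (s * z)).re := by
    simp only [Complex.sq_norm, Complex.normSq_apply]
    simp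
    ring
  rw [h4, h3]
  generalize (starRingEnd ℂ (c * g) * (s * z)).re = R
  field_simp
  linear_combination ((‖c‖ ^ 2 * ‖g‖ ^ 2 + s ^ 2 * ‖z‖ ^ 2 +
    2 * R)) * hcs

lemma lintegral_rotation_complexNormal {f : ℂ → ℝ≥0∞} (hf : Measurable f) (θ : ℝ) :
    ∫⁻ z, f (Complex.exp (θ * Complex.I) * z) ∂(complexNormal 1) =
      ∫⁻ z, f z ∂(complexNormal 1) := by
  have h := (LinearIsometryEquiv.measurePreserving (rotation (Circle.exp θ))).lintegral_comp
    (f := fun z => ENNReal.ofReal (Real.pi⁻¹ * Real.exp (-‖z‖ ^ 2)) * f z) (by fun_prop)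
  rw [lintegral_complexNormal_one (by fun_prop), lintegral_complexNormal_one hf, ← h]
  simp [rotation_apply, Circle.coe_exp]

lemma corrDensity_rotation (c g g' : ℂ) (θ : ℝ) :
    corrDensity c (Complex.exp (θ * Complex.I) * g) g' =
      phaseDensity ‖c‖ ‖g‖ ‖g'‖ (θ - (starRingEnd ℂ (c * g) * g').arg) := by
  have h : (starRingEnd ℂ (c * (Complex.exp (θ * Complex.I) * g)) * g').re =
      ‖c‖ * ‖g‖ * ‖g'‖ * Real.cos (θ - (starRingEnd ℂ (c * g) * g').arg) := by
    set w := starRingEnd ℂ (c * g) * g' with hw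
    have h1 : starRingEnd ℂ (c * (Complex.exp (θ * Complex.I) * g)) * g' =
        Complex.exp ((-θ : ℝ) * Complex.I) * w := by
      rw [hw]
      simp only [map_mul, ← Complex.exp_conj, Complex.conj_ofReal, Complex.conj_I]
      push_cast
      ring_nf
    have h2 : ‖w‖ = ‖c‖ * ‖g‖ * ‖g'‖ := by rw [hw]; simp
    rw [h1, ← h2]
    nth_rewrite 1 [← Complex.norm_mul_exp_arg_mul_I w]
    rw [mul_left_comm, ← Complex.exp_add, ← add_mul, ← Complex.ofReal_add, Complex.re_ofReal_mul,
      Complex.exp_ofReal_mul_I_re, ← Real.cos_neg]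
    congr 2
    ring
  rw [corrDensity, phaseDensity, h]
  simp

lemma continuous_phaseDensity (r u v : ℝ) : Continuous (phaseDensity r u v) := by
  unfold phaseDensity; fun_prop

lemma periodic_phaseDensity (r u v : ℝ) :
    Function.Periodic (phaseDensity r u v) (2 * Real.pi) := by
  intro θ; simp [phaseDensity]

lemma phaseDensity_nonneg {r : ℝ} (hr : r ^ 2 < 1) (u v θ : ℝ) : 0 ≤ phaseDensity r u v θ := by
  have : 0 < 1 - r ^ 2 := by linarith
  unfold phaseDensity; positivity

lemma integral_phaseDensity_add (r u v α : ℝ) :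
    ∫ θ in (0 : ℝ)..2 * Real.pi, phaseDensity r u v (θ + α) =
      ∫ θ in (0 : ℝ)..2 * Real.pi, phaseDensity r u v θ := by
  rw [intervalIntegral.integral_comp_add_right, zero_add, add_comm (2 * Real.pi)]
  simpa using (periodic_phaseDensity r u v).intervalIntegral_add_eq α 0

/-- Averaging over opposite phases turns the cross term into a hyperbolic cosine, which increases
when the geometric mean of `u²` and `v²` is replaced by their arithmetic mean; convexity of the
exponential then separates `u` from `v`. -/
lemma phaseDensity_add_antipode_le {r u v : ℝ} (hr : r ^ 2 < 1) (hu : 0 ≤ u) (hv : 0 ≤ v)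
    (θ : ℝ) :
    phaseDensity r u v θ + phaseDensity r u v (θ + Real.pi) ≤
      (phaseDensity r u u θ + phaseDensity r u u (θ + Real.pi) +
        (phaseDensity r v v θ + phaseDensity r v v (θ + Real.pi))) / 2 := by
  have hs : 0 < 1 - r ^ 2 := by linarith
  set b := r * Real.cos θ / (1 - r ^ 2) with hb
  set a := r ^ 2 / (1 - r ^ 2) with ha
  have key : ∀ p q : ℝ, phaseDensity r p q θ + phaseDensity r p q (θ + Real.pi) =
      (1 - r ^ 2)⁻¹ * (2 * (Real.exp (-a * (p ^ 2 + q ^ 2)) * Real.cosh (2 * b * (p * q)))) := by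
    intro p q
    rw [Real.cosh_eq, phaseDensity, phaseDensity, ← mul_add, Real.cos_add_pi]
    congr 1
    have e : ∀ E x y : ℝ, 2 * (E * ((x + y) / 2)) = E * x + E * y := by intros; ring
    rw [e, ← Real.exp_add, ← Real.exp_add, hb, ha]
    congr 2 <;> ring
  rw [key, key, key, ← mul_add, mul_div_assoc]
  refine mul_le_mul_of_nonneg_left ?_ (inv_nonneg.2 hs.le)
  have h1 : Real.cosh (2 * b * (u * v)) ≤ Real.cosh (b * (u ^ 2 + v ^ 2)) := by
    rw [Real.cosh_le_cosh, mul_assoc, abs_mul, abs_mul, abs_mul, abs_mul, abs_of_nonneg hu,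
      abs_of_nonneg hv, abs_of_nonneg (by positivity : 0 ≤ u ^ 2 + v ^ 2), abs_two]
    nlinarith [abs_nonneg b, sq_nonneg (u - v), mul_nonneg (abs_nonneg b) (sq_nonneg (u - v))]
  refine (mul_le_mul_of_nonneg_left (mul_le_mul_of_nonneg_left h1 (Real.exp_pos _).le)
    zero_le_two).trans ?_
  have h2 : ∀ A B : ℝ, Real.exp (A + B) ≤ (Real.exp (2 * A) + Real.exp (2 * B)) / 2 := by
    intro A B
    rw [Real.exp_add, two_mul, two_mul, Real.exp_add, Real.exp_add]
    nlinarith [sq_nonneg (Real.exp A - Real.exp B)]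
  have h3 := h2 ((b - a) * u ^ 2) ((b - a) * v ^ 2)
  have h4 := h2 ((-b - a) * u ^ 2) ((-b - a) * v ^ 2)
  have e : ∀ A B : ℝ, 2 * (Real.exp A * Real.cosh B) = Real.exp (A + B) + Real.exp (A - B) := by
    intro A B
    rw [Real.cosh_eq, sub_eq_add_neg A B, Real.exp_add, Real.exp_add]; ring
  rw [e, e, e]
  ring_nf at h3 h4 ⊢
  linarith

lemma integral_phaseDensity_le {r u v : ℝ} (hr : r ^ 2 < 1) (hu : 0 ≤ u) (hv : 0 ≤ v) :
    ∫ θ in (0 : ℝ)..2 * Real.pi, phaseDensity r u v θ ≤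
      ((∫ θ in (0 : ℝ)..2 * Real.pi, phaseDensity r u u θ) +
        ∫ θ in (0 : ℝ)..2 * Real.pi, phaseDensity r v v θ) / 2 := by
  have hi : ∀ p q α : ℝ, IntervalIntegrable (fun θ => phaseDensity r p q (θ + α)) volume 0
      (2 * Real.pi) := fun p q α =>
    ((continuous_phaseDensity r p q).comp (by fun_prop)).intervalIntegrable _ _
  have hi0 : ∀ p q : ℝ, IntervalIntegrable (phaseDensity r p q) volume 0
      (2 * Real.pi) := fun p q => (continuous_phaseDensity r p q).intervalIntegrable _ _
  have e : ∀ p q : ℝ, ∫ θ in (0 : ℝ)..2 * Real.pi,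
      (phaseDensity r p q θ + phaseDensity r p q (θ + Real.pi)) =
      2 * ∫ θ in (0 : ℝ)..2 * Real.pi, phaseDensity r p q θ := by
    intro p q
    rw [intervalIntegral.integral_add (hi0 _ _) (hi _ _ _), integral_phaseDensity_add]
    ring
  have h := intervalIntegral.integral_mono_on (μ := volume) Real.two_pi_pos.le
    ((hi0 u v).add (hi u v Real.pi))
    ((((hi0 u u).add (hi u u Real.pi)).add ((hi0 v v).add (hi v v Real.pi))).div_const 2)
    (fun θ _ => phaseDensity_add_antipode_le hr hu hv θ)
  rw [e, intervalIntegral.integral_div, intervalIntegral.integral_add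
    ((hi0 u u).add (hi u u Real.pi)) ((hi0 v v).add (hi v v Real.pi)), e, e] at h
  linarith

lemma lintegral_exp_complexNormal {k : ℝ} (hk : 0 < 1 + k) :
    ∫⁻ z, ENNReal.ofReal (Real.exp (-k * ‖z‖ ^ 2)) ∂(complexNormal 1) =
      ENNReal.ofReal (1 + k)⁻¹ := by
  rw [lintegral_complexNormal_one (by fun_prop)]
  have h := GaussianFourier.integral_rexp_neg_mul_sq_norm (V := ℂ) hk
  have hint : Integrable (fun z : ℂ => Real.exp (-(1 + k) * ‖z‖ ^ 2)) := by
    by_contra hn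
    rw [integral_undef hn] at h
    have : 0 < (Real.pi / (1 + k)) ^ ((Module.finrank ℝ ℂ : ℝ) / 2) := by positivity
    linarith
  rw [Complex.finrank_real_complex] at h
  norm_num at h
  have e : ∀ z : ℂ, ENNReal.ofReal (Real.pi⁻¹ * Real.exp (-‖z‖ ^ 2)) *
      ENNReal.ofReal (Real.exp (-k * ‖z‖ ^ 2)) =
      ENNReal.ofReal (Real.pi⁻¹ * Real.exp (-(1 + k) * ‖z‖ ^ 2)) := by
    intro z
    rw [← ENNReal.ofReal_mul (by positivity), mul_assoc, ← Real.exp_add]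
    congr 3
    ring
  simp_rw [e]
  rw [← ofReal_integral_eq_lintegral_ofReal (hint.const_mul _)
    (Eventually.of_forall fun z => by positivity), integral_const_mul]
  congr 1
  have : ∫ z : ℂ, Real.exp (-(1 + k) * ‖z‖ ^ 2) = Real.pi / (1 + k) := by
    rw [← h]; congr 1; ext z; ring_nf
  rw [this]
  have := Real.pi_ne_zero
  field_simp

/-- The Poisson kernel has mean one on the circle. -/
lemma integral_inv_one_add_sq_sub {r : ℝ} (hr0 : 0 ≤ r) (hr : r < 1) :
    ∫ θ in (0 : ℝ)..2 * Real.pi, (1 + r ^ 2 - 2 * (r * Real.cos θ))⁻¹ =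
      2 * Real.pi * (1 - r ^ 2)⁻¹ := by
  have hs : 0 < 1 - r ^ 2 := by nlinarith
  have h := DiffContOnCl.circleAverage_poissonKernel_smul' (f := fun _ : ℂ => (1 : ℂ)) (c := 0)
    (R := 1) (w := (r : ℂ)) diffContOnCl_const (by simpa [abs_of_nonneg hr0] using hr)
  have e : ∀ θ : ℝ, ((‖circleMap 0 1 θ - 0‖ ^ 2 - ‖(r : ℂ) - 0‖ ^ 2) /
      ‖circleMap 0 1 θ - 0 - ((r : ℂ) - 0)‖ ^ 2) =
      (1 - r ^ 2) * (1 + r ^ 2 - 2 * (r * Real.cos θ))⁻¹ := by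
    intro θ
    have : ‖circleMap 0 1 θ - r‖ ^ 2 = 1 + r ^ 2 - 2 * (r * Real.cos θ) := by
      rw [Complex.sq_norm, Complex.normSq_apply]
      simp [circleMap, Complex.exp_re, Complex.exp_im]
      nlinarith [Real.sin_sq_add_cos_sq θ]
    simp only [sub_zero]
    rw [this]
    simp [div_eq_mul_inv]
  rw [Real.circleAverage] at h
  simp_rw [e] at h
  have h2 := congrArg Complex.re h
  simp only [Complex.real_smul, mul_one, Complex.one_re] at h2
  rw [intervalIntegral.integral_ofReal, ← Complex.ofReal_mul, Complex.ofReal_re,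
    intervalIntegral.integral_const_mul] at h2
  have := Real.pi_ne_zero
  field_simp at h2 ⊢
  linarith

lemma lintegral_weighted_swap {α β : Type*} [MeasurableSpace α] [MeasurableSpace β]
    {ρ : Measure α} {μ : Measure β} [SFinite ρ] [SFinite μ] {H : β → β → ℝ≥0∞}
    {D : α → β → β → ℝ≥0∞} (hH : Measurable (Function.uncurry H))
    (hD : Measurable fun p : (α × β) × β => D p.1.1 p.1.2 p.2) :
    ∫⁻ t, ∫⁻ x, ∫⁻ y, H x y * D t x y ∂μ ∂μ ∂ρ = ∫⁻ x, ∫⁻ y, H x y * ∫⁻ t, D t x y ∂ρ ∂μ ∂μ := by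
  have hm : Measurable fun p : (α × β) × β => H p.1.2 p.2 * D p.1.1 p.1.2 p.2 :=
    (hH.comp ((measurable_snd.comp measurable_fst).prodMk measurable_snd)).mul hD
  have hm1 : ∀ x, Measurable fun p : α × β => H x p.2 * D p.1 x p.2 := fun x =>
    hm.comp ((measurable_fst.prodMk measurable_const).prodMk measurable_snd)
  rw [lintegral_lintegral_swap (Measurable.lintegral_prod_right' hm).aemeasurable]
  refine lintegral_congr fun x => ?_
  rw [lintegral_lintegral_swap (hm1 x).aemeasurable]
  refine lintegral_congr fun y => lintegral_const_mul _ ?_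
  exact hD.comp ((measurable_id.prodMk measurable_const).prodMk measurable_const)

/-- A nonnegative kernel on `ℂ × ℂ` that is symmetric, depends on the phase of neither argument and
has mean one in each of them, has mean at most `1 / (1 - |c|²)` under a pair of standard complex
normals of correlation `c`. -/
theorem lintegral_correlated_pair_le {H : ℂ → ℂ → ℝ≥0∞} (hH : Measurable (Function.uncurry H))
    (hsymm : ∀ g g', H g g' = H g' g)
    (hphase : ∀ (θ : ℝ) (g g' : ℂ), H (Complex.exp (θ * Complex.I) * g) g' = H g g')
    (hone : ∀ g, ∫⁻ g', H g g' ∂(complexNormal 1) = 1)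
    {c : ℂ} {s : ℝ} (hs : 0 < s) (hcs : ‖c‖ ^ 2 + s ^ 2 = 1) :
    ∫⁻ g, ∫⁻ g', H g (c * g + s * g') ∂(complexNormal 1) ∂(complexNormal 1) ≤
      ENNReal.ofReal (1 - ‖c‖ ^ 2)⁻¹ := by
  set γ := complexNormal 1 with hγ
  set r := ‖c‖ with hr
  have hr0 : 0 ≤ r := norm_nonneg c
  have hr2 : r ^ 2 < 1 := by nlinarith
  have hr1 : r < 1 := by nlinarith
  have hs' : 0 < 1 - r ^ 2 := by linarith
  have h2pi : (0 : ℝ) < 2 * Real.pi := Real.two_pi_pos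
  have hHg : ∀ g, Measurable (H g) := fun g => hH.comp measurable_prodMk_left
  have hDm : Measurable fun p : (ℝ × ℂ) × ℂ => ENNReal.ofReal
      (corrDensity c (Complex.exp (p.1.1 * Complex.I) * p.1.2) p.2) := by
    unfold corrDensity; fun_prop
  have hPm : Measurable fun p : ℝ × ℝ => ENNReal.ofReal (phaseDensity r p.2 p.2 p.1) := by
    unfold phaseDensity; fun_prop
  set F := ∫⁻ g, ∫⁻ g', H g (c * g + s * g') ∂γ ∂γ with hF
  have hrot : ∀ θ : ℝ, F = ∫⁻ g, ∫⁻ g', H g g' *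
      ENNReal.ofReal (corrDensity c (Complex.exp (θ * Complex.I) * g) g') ∂γ ∂γ := by
    intro θ
    have h1 : F = ∫⁻ g, ∫⁻ g', H g g' * ENNReal.ofReal (corrDensity c g g') ∂γ ∂γ :=
      lintegral_congr fun g => lintegral_correlated (hHg g) hs hcs g
    have hm : Measurable fun g => ∫⁻ g', H g g' * ENNReal.ofReal (corrDensity c g g') ∂γ := by
      refine Measurable.lintegral_prod_right' (f := fun p : ℂ × ℂ =>
        H p.1 p.2 * ENNReal.ofReal (corrDensity c p.1 p.2)) (hH.mul ?_)
      unfold corrDensity; fun_prop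
    rw [h1, ← lintegral_rotation_complexNormal hm θ]
    simp_rw [hphase]
    rfl
  -- the phase average of the density, bounded by its values at equal moduli
  set T : ℝ → ℝ := fun u => ∫ θ in (0 : ℝ)..2 * Real.pi, phaseDensity r u u θ with hT
  have hof : ∀ u v α : ℝ, ∫⁻ θ in Set.Ioc (0 : ℝ) (2 * Real.pi),
      ENNReal.ofReal (phaseDensity r u v (θ + α)) =
      ENNReal.ofReal (∫ θ in (0 : ℝ)..2 * Real.pi, phaseDensity r u v θ) := by
    intro u v α
    rw [← integral_phaseDensity_add r u v α, intervalIntegral.integral_of_le h2pi.le]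
    refine (ofReal_integral_eq_lintegral_ofReal ?_
      (Eventually.of_forall fun θ => phaseDensity_nonneg hr2 _ _ _)).symm
    exact (((continuous_phaseDensity r u v).comp
      (continuous_add_const α)).integrableOn_Icc).mono_set Set.Ioc_subset_Icc_self
  have hT0 : ∀ u, 0 ≤ T u := fun u =>
    intervalIntegral.integral_nonneg h2pi.le fun θ _ => phaseDensity_nonneg hr2 _ _ _
  have hTof : ∀ u, ENNReal.ofReal (T u) = ∫⁻ θ in Set.Ioc (0 : ℝ) (2 * Real.pi),
      ENNReal.ofReal (phaseDensity r u u θ) := by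
    intro u; simpa using (hof u u 0).symm
  have hTm : Measurable fun u : ℝ => ENNReal.ofReal (T u) := by
    simp_rw [hTof]
    exact Measurable.lintegral_prod_left' hPm
  have hTm' : Measurable fun g : ℂ => ENNReal.ofReal (T ‖g‖ / 2) := by
    simp_rw [ENNReal.ofReal_div_of_pos two_pos]
    exact (hTm.comp measurable_norm).div_const _
  have hD : ∀ g g' : ℂ, ∫⁻ θ in Set.Ioc (0 : ℝ) (2 * Real.pi), ENNReal.ofReal
      (corrDensity c (Complex.exp (θ * Complex.I) * g) g') ≤
      ENNReal.ofReal (T ‖g‖ / 2) + ENNReal.ofReal (T ‖g'‖ / 2) := by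
    intro g g'
    simp_rw [corrDensity_rotation, sub_eq_add_neg]
    rw [hof, ← ENNReal.ofReal_add (by linarith [hT0 ‖g‖]) (by linarith [hT0 ‖g'‖]), ← add_div]
    exact ENNReal.ofReal_le_ofReal (integral_phaseDensity_le hr2 (norm_nonneg _) (norm_nonneg _))
  have hdiag : ∫⁻ g, ENNReal.ofReal (T ‖g‖) ∂γ = ENNReal.ofReal (2 * Real.pi * (1 - r ^ 2)⁻¹) := by
    simp_rw [hTof]
    rw [lintegral_lintegral_swap
      (by exact (hPm.comp (measurable_snd.prodMk measurable_fst.norm)).aemeasurable)]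
    have hpos : ∀ θ : ℝ, 0 < 1 + r ^ 2 - 2 * (r * Real.cos θ) := by
      intro θ
      nlinarith [Real.cos_le_one θ, mul_le_mul_of_nonneg_left (Real.cos_le_one θ) hr0]
    have hin : ∀ θ : ℝ, ∫⁻ g, ENNReal.ofReal (phaseDensity r ‖g‖ ‖g‖ θ) ∂γ =
        ENNReal.ofReal (1 + r ^ 2 - 2 * (r * Real.cos θ))⁻¹ := by
      intro θ
      set k := 2 * (r ^ 2 - r * Real.cos θ) / (1 - r ^ 2) with hk
      have hk1 : 1 + k = (1 + r ^ 2 - 2 * (r * Real.cos θ)) / (1 - r ^ 2) := by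
        rw [hk]; field_simp; ring
      have e : ∀ g : ℂ, ENNReal.ofReal (phaseDensity r ‖g‖ ‖g‖ θ) =
          ENNReal.ofReal (1 - r ^ 2)⁻¹ * ENNReal.ofReal (Real.exp (-k * ‖g‖ ^ 2)) := by
        intro g
        rw [← ENNReal.ofReal_mul (inv_nonneg.2 hs'.le), phaseDensity, hk]
        congr 3
        ring
      simp_rw [e]
      rw [lintegral_const_mul _ (by fun_prop),
        lintegral_exp_complexNormal (by rw [hk1]; exact div_pos (hpos θ) hs'),
        ← ENNReal.ofReal_mul (inv_nonneg.2 hs'.le), hk1]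
      congr 1
      have := (hpos θ).ne'
      field_simp
    simp_rw [hin]
    rw [← integral_inv_one_add_sq_sub hr0 hr1, intervalIntegral.integral_of_le h2pi.le,
      ofReal_integral_eq_lintegral_ofReal ?_
        (Eventually.of_forall fun θ => (inv_nonneg.2 (hpos θ).le))]
    have hc : Continuous fun θ : ℝ => (1 + r ^ 2 - 2 * (r * Real.cos θ))⁻¹ :=
      Continuous.inv₀ (by fun_prop) fun θ => (hpos θ).ne'
    exact hc.integrableOn_Icc.mono_set Set.Ioc_subset_Icc_self
  have hmain : ENNReal.ofReal (2 * Real.pi) * F ≤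
      ENNReal.ofReal (2 * Real.pi) * ENNReal.ofReal (1 - r ^ 2)⁻¹ := by
    calc ENNReal.ofReal (2 * Real.pi) * F
        = ∫⁻ _ in Set.Ioc 0 (2 * Real.pi), F := by simp [mul_comm]
      _ = ∫⁻ θ in Set.Ioc (0 : ℝ) (2 * Real.pi), ∫⁻ g, ∫⁻ g', H g g' *
            ENNReal.ofReal (corrDensity c (Complex.exp (θ * Complex.I) * g) g') ∂γ ∂γ :=
          lintegral_congr fun θ => hrot θ
      _ = ∫⁻ g, ∫⁻ g', H g g' * (∫⁻ θ : ℝ,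
            ENNReal.ofReal (corrDensity c (Complex.exp (θ * Complex.I) * g) g')
              ∂(volume.restrict (Set.Ioc (0 : ℝ) (2 * Real.pi)))) ∂γ ∂γ := by
          exact lintegral_weighted_swap hH hDm
      _ ≤ ∫⁻ g, ∫⁻ g', H g g' * (ENNReal.ofReal (T ‖g‖ / 2) + ENNReal.ofReal (T ‖g'‖ / 2)) ∂γ ∂γ :=
          lintegral_mono fun g => lintegral_mono fun g' => mul_le_mul_right (hD g g') _
      _ = (∫⁻ g, ∫⁻ g', H g g' * ENNReal.ofReal (T ‖g‖ / 2) ∂γ ∂γ) +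
            ∫⁻ g, ∫⁻ g', H g g' * ENNReal.ofReal (T ‖g'‖ / 2) ∂γ ∂γ := by
          simp_rw [mul_add]
          rw [← lintegral_add_left]
          · exact lintegral_congr fun g => lintegral_add_left ((hHg g).mul_const _) _
          · exact Measurable.lintegral_prod_right' (f := fun p : ℂ × ℂ =>
              H p.1 p.2 * ENNReal.ofReal (T ‖p.1‖ / 2)) (hH.mul (hTm'.comp measurable_fst))
      _ = (∫⁻ g, ENNReal.ofReal (T ‖g‖ / 2) ∂γ) + ∫⁻ g, ENNReal.ofReal (T ‖g‖ / 2) ∂γ := by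
          congr 1
          · refine lintegral_congr fun g => ?_
            rw [lintegral_mul_const _ (hHg g), hone, one_mul]
          · rw [lintegral_lintegral_swap
              (by exact (hH.mul (hTm'.comp measurable_snd)).aemeasurable)]
            refine lintegral_congr fun g => ?_
            simp_rw [hsymm _ g]
            rw [lintegral_mul_const _ (hHg g), hone, one_mul]
      _ = ∫⁻ g, ENNReal.ofReal (T ‖g‖) ∂γ := by
          rw [← lintegral_add_left hTm']
          refine lintegral_congr fun g => ?_
          rw [← ENNReal.ofReal_add (by linarith [hT0 ‖g‖]) (by linarith [hT0 ‖g‖]), add_halves]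
      _ = _ := by rw [hdiag, ENNReal.ofReal_mul h2pi.le]
  rwa [ENNReal.mul_le_mul_iff_right (by simpa using Real.pi_pos) ENNReal.ofReal_ne_top] at hmain

/-! ### Polar coordinates and the overlap of points on the sphere -/

section Polar

variable {V : Type*} [NormedAddCommGroup V] [InnerProductSpace ℝ V] [FiniteDimensional ℝ V]
  [MeasurableSpace V] [BorelSpace V]

/-- Integration in polar coordinates of a product of an angular and a radial function. -/
lemma lintegral_polar [Nontrivial V] {h : Metric.sphere (0 : V) 1 → ℝ≥0∞} (hh : Measurable h)
    {k : ℝ → ℝ≥0∞} (hk : Measurable k) {F : V → ℝ≥0∞}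
    (hF : ∀ (u : Metric.sphere (0 : V) 1) (r : ℝ), 0 < r → F (r • (u : V)) = h u * k r) :
    ∫⁻ v, F v = (∫⁻ u, h u ∂(volume : Measure V).toSphere) *
      ∫⁻ r in Set.Ioi (0 : ℝ), ENNReal.ofReal (r ^ (Module.finrank ℝ V - 1)) * k r := by
  have hmp := (volume : Measure V).measurePreserving_homeomorphUnitSphereProd
  have h1 : ∫⁻ v, F v = ∫⁻ v : ({0}ᶜ : Set V), F v ∂((volume : Measure V).comap (↑)) := by
    rw [lintegral_subtype_comap (measurableSet_singleton 0).compl, restrict_compl_singleton]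
  have h2 : ∀ v : ({0}ᶜ : Set V), F v =
      (fun p : Metric.sphere (0 : V) 1 × Set.Ioi (0 : ℝ) => h p.1 * k p.2)
        (homeomorphUnitSphereProd V v) := by
    intro v
    have hv : (v : V) ≠ 0 := v.2
    have := hF (homeomorphUnitSphereProd V v).1 ‖(v : V)‖ (norm_pos_iff.2 hv)
    rw [homeomorphUnitSphereProd_apply_fst_coe, smul_inv_smul₀ (norm_ne_zero_iff.2 hv)] at this
    rw [this]
    simp
  have hk' : Measurable fun r : Set.Ioi (0 : ℝ) => k r := hk.comp measurable_subtype_coe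
  rw [h1, lintegral_congr h2, hmp.lintegral_comp (f := fun p => h p.1 * k p.2)
    ((hh.comp measurable_fst).mul (hk'.comp measurable_snd)),
    lintegral_prod_mul hh.aemeasurable hk'.aemeasurable, Measure.volumeIoiPow,
    lintegral_withDensity_eq_lintegral_mul _ (by fun_prop) hk']
  congr 1
  exact lintegral_subtype_comap measurableSet_Ioi
    (fun r : ℝ => ENNReal.ofReal (r ^ (Module.finrank ℝ V - 1)) * k r)

lemma toSphere_univ_of_even [Nontrivial V] {m : ℕ} (hm : Module.finrank ℝ V = 2 * (m + 1)) :
    (volume : Measure V).toSphere Set.univ =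
      ENNReal.ofReal (2 * Real.pi ^ (m + 1) / m.factorial) := by
  rw [Measure.toSphere_apply_univ, InnerProductSpace.volume_ball_of_dim_even hm, hm,
    ENNReal.ofReal_one, one_pow, one_mul, ← ENNReal.ofReal_natCast,
    ← ENNReal.ofReal_mul (by positivity), Nat.factorial_succ]
  congr 1
  push_cast
  field_simp

lemma lintegral_pow_mul_exp_neg_sq (j : ℕ) :
    ∫⁻ r in Set.Ioi (0 : ℝ), ENNReal.ofReal (r ^ (2 * j + 1) * Real.exp (-r ^ 2)) =
      ENNReal.ofReal (j.factorial / 2) := by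
  have h := integral_rpow_mul_exp_neg_rpow (p := 2) (q := (2 * j + 1 : ℕ)) two_pos
    (by push_cast; linarith [Nat.cast_nonneg (α := ℝ) j])
  have e : (((2 * j + 1 : ℕ) : ℝ) + 1) / 2 = j + 1 := by push_cast; ring
  rw [e, Real.Gamma_nat_eq_factorial] at h
  simp_rw [Real.rpow_natCast, Real.rpow_two] at h
  have hpos : (0 : ℝ) < 1 / 2 * j.factorial := by positivity
  rw [← ofReal_integral_eq_lintegral_ofReal, h]
  · congr 1; ring
  · by_contra hn
    rw [integral_undef hn] at h
    linarith
  · filter_upwards [ae_restrict_mem measurableSet_Ioi] with r hr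
    have : 0 < r := hr
    positivity

/-- A Gaussian moment of negative order: `E ‖v‖^(-2n)` up to the normalization of the density. -/
lemma lintegral_inv_norm_sq_pow_mul_exp {n p : ℕ} (hV : Module.finrank ℝ V = 2 * (n + p + 1)) :
    ∫⁻ v : V, (ENNReal.ofReal (‖v‖ ^ 2))⁻¹ ^ n * ENNReal.ofReal (Real.exp (-‖v‖ ^ 2)) =
      ENNReal.ofReal (2 * Real.pi ^ (n + p + 1) / (n + p).factorial) *
        ENNReal.ofReal (p.factorial / 2) := by
  have : Nontrivial V := Module.nontrivial_of_finrank_pos (R := ℝ) (by omega)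
  rw [lintegral_polar (h := fun _ => 1) measurable_const
    (k := fun r => (ENNReal.ofReal (r ^ 2))⁻¹ ^ n * ENNReal.ofReal (Real.exp (-r ^ 2)))
    (by fun_prop) (fun u r hr => by simp [norm_smul])]
  rw [lintegral_const, one_mul, toSphere_univ_of_even hV, ← lintegral_pow_mul_exp_neg_sq p, hV]
  congr 1
  refine setLIntegral_congr_fun measurableSet_Ioi fun r hr => ?_
  have hr : 0 < r := hr
  rw [← ENNReal.ofReal_inv_of_pos (by positivity), ← ENNReal.ofReal_pow (by positivity),
    ← ENNReal.ofReal_mul (by positivity), ← ENNReal.ofReal_mul (by positivity), ← mul_assoc]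
  congr 2
  rw [show 2 * (n + p + 1) - 1 = 2 * p + 1 + 2 * n by omega, pow_add, inv_pow, ← pow_mul]
  field_simp

lemma lintegral_norm_sq_mul_exp (hV : Module.finrank ℝ V = 2) :
    ∫⁻ v : V, ENNReal.ofReal (‖v‖ ^ 2 * Real.exp (-‖v‖ ^ 2)) = ENNReal.ofReal Real.pi := by
  have : Nontrivial V := Module.nontrivial_of_finrank_pos (R := ℝ) (by omega)
  rw [lintegral_polar (h := fun _ => 1) measurable_const
    (k := fun r => ENNReal.ofReal (r ^ 2 * Real.exp (-r ^ 2)))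
    (by fun_prop) (fun u r hr => by simp [norm_smul])]
  have e : ∫⁻ r in Set.Ioi (0 : ℝ), ENNReal.ofReal (r ^ (Module.finrank ℝ V - 1)) *
      ENNReal.ofReal (r ^ 2 * Real.exp (-r ^ 2)) = ENNReal.ofReal ((1 : ℕ).factorial / 2) := by
    rw [← lintegral_pow_mul_exp_neg_sq 1, hV]
    refine setLIntegral_congr_fun measurableSet_Ioi fun r hr => ?_
    have hr : 0 < r := hr
    rw [← ENNReal.ofReal_mul (by positivity)]
    congr 1
    ring
  rw [e, lintegral_const, one_mul, toSphere_univ_of_even (m := 0) (by simpa using hV),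
    ← ENNReal.ofReal_mul (by positivity)]
  congr 1
  simp
  ring

end Polar

lemma finrank_real_sig (d : ℕ) : Module.finrank ℝ (Sig d) = 2 * d := by
  have h := Module.finrank_mul_finrank ℝ ℂ (Sig d)
  rw [Complex.finrank_real_complex, finrank_euclideanSpace_fin] at h
  exact h.symm

lemma lintegral_unifSphere {d : ℕ} {f : Sig d → ℝ≥0∞} (hf : Measurable f) :
    ∫⁻ x, f x ∂(unifSphere d) = ((volume : Measure (Sig d)).toSphere Set.univ)⁻¹ *
      ∫⁻ u, f (Real.sqrt d • (u : Sig d)) ∂(volume : Measure (Sig d)).toSphere := by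
  rw [unifSphere, lintegral_map hf (by fun_prop), lintegral_smul_measure, smul_eq_mul]

lemma isProbabilityMeasure_unifSphere {d : ℕ} (hd : 0 < d) :
    IsProbabilityMeasure (unifSphere d) := by
  have : Nontrivial (Sig d) :=
    Module.nontrivial_of_finrank_pos (R := ℝ) (by rw [finrank_real_sig]; omega)
  have : IsProbabilityMeasure (((volume : Measure (Sig d)).toSphere Set.univ)⁻¹ •
      (volume : Measure (Sig d)).toSphere) := by
    constructor
    rw [Measure.smul_apply, smul_eq_mul, ENNReal.inv_mul_cancel _ (measure_ne_top _ _)]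
    exact fun h => Measure.toSphere_ne_zero (volume : Measure (Sig d))
      (Measure.measure_univ_eq_zero.1 h)
  exact Measure.isProbabilityMeasure_map (by fun_prop)

lemma ae_norm_sq_unifSphere (d : ℕ) : ∀ᵐ x ∂(unifSphere d), ‖x‖ ^ 2 = d := by
  rw [unifSphere, ae_map_iff (by fun_prop) (measurableSet_eq_fun (by fun_prop) measurable_const)]
  refine Eventually.of_forall fun u => ?_
  simp [norm_smul]

/-- For `x'` uniform on the sphere and `x` on the sphere, the squared normalized overlap
`m = |⟨x, x'⟩|² / d²` is Beta distributed; this is its moment `E m (1 - m)⁻ⁿ`, in dimension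
`d = n + p + 2`. The proof integrates `|z₁|² |z₂|⁻²ⁿ exp (-‖z‖²)` over the whole space, where `z₁`
and `z₂` are the components of `z` along and orthogonal to `x`, once as a product and once in polar
coordinates: homogeneity of the prefactor lets the moment come out of the second computation. -/
lemma lintegral_overlap_unifSphere {d n p : ℕ} (hd : d = n + p + 2) {x : Sig d}
    (hx : ‖x‖ ^ 2 = d) :
    ∫⁻ x', ENNReal.ofReal (‖(inner ℂ x x' : ℂ)‖ ^ 2 / (d : ℝ) ^ 2) *
      (ENNReal.ofReal (1 - ‖(inner ℂ x x' : ℂ)‖ ^ 2 / (d : ℝ) ^ 2))⁻¹ ^ n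
        ∂(unifSphere d) = ENNReal.ofReal ((n + p + 1) / ((p + 2) * (p + 1))) := by
  have hd0 : (0 : ℝ) < d := by rw [hd]; positivity
  have hx0 : x ≠ 0 := by
    rintro rfl
    rw [norm_zero, zero_pow two_ne_zero] at hx
    exact hd0.ne hx
  have hdim : Module.finrank ℝ (Sig d) = 2 * (n + p + 1 + 1) := by rw [finrank_real_sig, hd]
  have hnt : Nontrivial (Sig d) := Module.nontrivial_of_finrank_pos (R := ℝ) (by omega)
  set K : Submodule ℂ (Sig d) := Submodule.span ℂ {x} with hK
  let _ : InnerProductSpace ℝ K := InnerProductSpace.complexToReal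
  let _ : InnerProductSpace ℝ (Kᗮ : Submodule ℂ (Sig d)) := InnerProductSpace.complexToReal
  let φ : Sig d ≃ₗᵢ[ℝ] WithLp 2 (K × Kᗮ) :=
    { K.orthogonalDecomposition with
      map_smul' := fun r z => map_smul K.orthogonalDecomposition (r : ℂ) z }
  have hφ : MeasurePreserving (fun z => (φ z).ofLp) volume volume :=
    (WithLp.volume_preserving_ofLp K Kᗮ).comp φ.measurePreserving
  have hKdim : Module.finrank ℝ K = 2 := by
    rw [finrank_real_of_complex, finrank_span_singleton hx0]
  have hKodim : Module.finrank ℝ (Kᗮ : Submodule ℂ (Sig d)) = 2 * (n + p + 1) := by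
    have : Fact (Module.finrank ℂ (Sig d) = n + p + 1 + 1) := ⟨by simp [hd]⟩
    rw [finrank_real_of_complex, Submodule.finrank_orthogonal_span_singleton (n := n + p + 1) hx0]
  have hfst : ∀ z : Sig d, ‖(φ z).ofLp.1‖ ^ 2 = ‖(inner ℂ x z : ℂ)‖ ^ 2 / d := by
    intro z
    have h1 : ‖(φ z).ofLp.1‖ = ‖K.starProjection z‖ := rfl
    rw [h1, Submodule.starProjection_singleton, norm_smul, mul_pow, hx, norm_div, div_pow]
    simp
    field_simp
  have hsnd : ∀ z : Sig d, ‖(φ z).ofLp.2‖ ^ 2 = ‖z‖ ^ 2 - ‖(inner ℂ x z : ℂ)‖ ^ 2 / d := by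
    intro z
    have h1 := WithLp.prod_norm_sq_eq_of_L2 (φ z)
    rw [φ.norm_map] at h1
    have h2 := hfst z
    simp only [WithLp.ofLp_fst, WithLp.ofLp_snd] at h1 h2 ⊢
    linarith
  set h : Metric.sphere (0 : Sig d) 1 → ℝ≥0∞ := fun u =>
    ENNReal.ofReal (‖(inner ℂ x (u : Sig d) : ℂ)‖ ^ 2 / d) *
      (ENNReal.ofReal (1 - ‖(inner ℂ x (u : Sig d) : ℂ)‖ ^ 2 / d))⁻¹ ^ n with hh
  set G : K × (Kᗮ : Submodule ℂ (Sig d)) → ℝ≥0∞ := fun q =>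
    ENNReal.ofReal (‖q.1‖ ^ 2 * Real.exp (-‖q.1‖ ^ 2)) *
      ((ENNReal.ofReal (‖q.2‖ ^ 2))⁻¹ ^ n * ENNReal.ofReal (Real.exp (-‖q.2‖ ^ 2))) with hG
  have hGm : Measurable G := by fun_prop
  have hprod : ∫⁻ z, G (φ z).ofLp = ENNReal.ofReal Real.pi *
      (ENNReal.ofReal (2 * Real.pi ^ (n + p + 1) / (n + p).factorial) *
        ENNReal.ofReal (p.factorial / 2)) := by
    rw [hφ.lintegral_comp hGm, Measure.volume_eq_prod,
      lintegral_prod_mul (f := fun k : K => ENNReal.ofReal (‖k‖ ^ 2 * Real.exp (-‖k‖ ^ 2)))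
        (g := fun w : (Kᗮ : Submodule ℂ (Sig d)) => (ENNReal.ofReal (‖w‖ ^ 2))⁻¹ ^ n *
          ENNReal.ofReal (Real.exp (-‖w‖ ^ 2))) (by fun_prop) (by fun_prop),
      lintegral_norm_sq_mul_exp hKdim, lintegral_inv_norm_sq_pow_mul_exp hKodim]
  have hpolar : ∫⁻ z, G (φ z).ofLp = (∫⁻ u, h u ∂(volume : Measure (Sig d)).toSphere) *
      ENNReal.ofReal ((p + 2).factorial / 2) := by
    rw [lintegral_polar (h := h) (by fun_prop)
      (k := fun r => ENNReal.ofReal (r ^ 2) * (ENNReal.ofReal (r ^ 2))⁻¹ ^ n *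
        ENNReal.ofReal (Real.exp (-r ^ 2))) (by fun_prop) ?_]
    · congr 1
      rw [← lintegral_pow_mul_exp_neg_sq, hdim]
      refine setLIntegral_congr_fun measurableSet_Ioi fun r hr => ?_
      have hr : 0 < r := hr
      rw [← ENNReal.ofReal_inv_of_pos (by positivity), ← ENNReal.ofReal_pow (by positivity),
        ← ENNReal.ofReal_mul (by positivity), ← ENNReal.ofReal_mul (by positivity),
        ← ENNReal.ofReal_mul (by positivity), ← mul_assoc]
      congr 2
      rw [show 2 * (n + p + 1 + 1) - 1 = 2 * p + 3 + 2 * n by omega, pow_add, inv_pow, ← pow_mul]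
      field_simp
      ring
    · intro u r hr
      have hu : ‖(u : Sig d)‖ = 1 := by simp
      have e1 : ‖(inner ℂ x (r • (u : Sig d)) : ℂ)‖ ^ 2 / d =
          r ^ 2 * (‖(inner ℂ x (u : Sig d) : ℂ)‖ ^ 2 / d) := by
        rw [inner_smul_right_eq_smul, norm_smul, mul_pow, Real.norm_eq_abs, sq_abs]
        ring
      have e2 : ‖r • (u : Sig d)‖ ^ 2 = r ^ 2 := by
        rw [norm_smul, hu, mul_one, Real.norm_eq_abs, sq_abs]
      have hr2 : ENNReal.ofReal (r ^ 2) ≠ 0 := by simp [hr.ne']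
      simp only [hG, hh, hfst, hsnd, e1, e2]
      set m := ‖(inner ℂ x (u : Sig d) : ℂ)‖ ^ 2 / d with hm
      have hm0 : 0 ≤ m := by positivity
      rw [show r ^ 2 - r ^ 2 * m = r ^ 2 * (1 - m) by ring, ENNReal.ofReal_mul (sq_nonneg r),
        ENNReal.mul_inv (Or.inl hr2) (Or.inl ENNReal.ofReal_ne_top), mul_pow,
        ENNReal.ofReal_mul (by positivity), ENNReal.ofReal_mul (sq_nonneg r)]
      have e3 : ENNReal.ofReal (Real.exp (-r ^ 2)) = ENNReal.ofReal (Real.exp (-(r ^ 2 * m))) *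
          ENNReal.ofReal (Real.exp (-(r ^ 2 * (1 - m)))) := by
        rw [← ENNReal.ofReal_mul (Real.exp_pos _).le, ← Real.exp_add]
        congr 2
        ring
      rw [e3]
      ring
  have hcongr : ∀ u : Metric.sphere (0 : Sig d) 1,
      ENNReal.ofReal (‖(inner ℂ x (Real.sqrt d • (u : Sig d)) : ℂ)‖ ^ 2 / (d : ℝ) ^ 2) *
      (ENNReal.ofReal (1 - ‖(inner ℂ x (Real.sqrt d • (u : Sig d)) : ℂ)‖ ^ 2 / (d : ℝ) ^ 2))⁻¹ ^ n
        = h u := by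
    intro u
    have e : ‖(inner ℂ x (Real.sqrt d • (u : Sig d)) : ℂ)‖ ^ 2 / (d : ℝ) ^ 2 =
        ‖(inner ℂ x (u : Sig d) : ℂ)‖ ^ 2 / d := by
      rw [inner_smul_right_eq_smul, norm_smul, mul_pow, Real.norm_eq_abs, sq_abs,
        Real.sq_sqrt hd0.le]
      field_simp
    rw [e]
  rw [lintegral_unifSphere (by fun_prop), lintegral_congr hcongr]
  have hpos : (0 : ℝ) < (p + 2).factorial / 2 := by positivity
  have hI := (ENNReal.eq_div_iff (ENNReal.ofReal_pos.2 hpos).ne' ENNReal.ofReal_ne_top).2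
    ((mul_comm _ _).trans (hprod.symm.trans hpolar).symm)
  rw [hI, toSphere_univ_of_even hdim, ← ENNReal.ofReal_mul (by positivity),
    ← ENNReal.ofReal_mul (by positivity), ← ENNReal.ofReal_inv_of_pos (by positivity),
    ← ENNReal.ofReal_div_of_pos hpos, ← ENNReal.ofReal_mul (by positivity)]
  congr 1
  have := Real.pi_ne_zero
  rw [Nat.factorial_succ (n + p), Nat.factorial_succ (p + 1), Nat.factorial_succ p]
  push_cast
  field_simp
  ring

/-! ### A Bayesian lower bound by a second moment -/

section Bayes

variable {X Y H : Type*} [MeasurableSpace X] [MeasurableSpace Y] [NormedAddCommGroup H]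
  [InnerProductSpace ℂ H] [CompleteSpace H]

lemma enorm_integral_sq_le {κ : Measure X} [SFinite κ] {T : X → H} (hT : Integrable T κ) :
    ENNReal.ofReal (‖∫ x, T x ∂κ‖ ^ 2) ≤ ∫⁻ x, ∫⁻ x', ‖(inner ℂ (T x) (T x') : ℂ)‖ₑ ∂κ ∂κ := by
  set V := ∫ x, T x ∂κ with hV
  have h1 : ENNReal.ofReal (‖V‖ ^ 2) = ‖(inner ℂ V V : ℂ)‖ₑ := by
    rw [inner_self_eq_norm_sq_to_K, ← ofReal_norm]
    simp
  have h2 : ∀ v : H, (inner ℂ v V : ℂ) = ∫ x, (inner ℂ v (T x) : ℂ) ∂κ := fun v =>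
    (integral_inner hT v).symm
  rw [h1, h2]
  refine (enorm_integral_le_lintegral_enorm _).trans (lintegral_mono fun x => ?_)
  rw [← enorm_norm, norm_inner_symm, enorm_norm, h2]
  exact enorm_integral_le_lintegral_enorm _

/-- The mean square error of a constant estimate `b` of a vector of fixed length `√R` is at least
its second moment minus the squared norm of its mean; the latter is bounded by the overlap of two
replicas. -/
lemma sq_norm_mul_measure_le {κ : Measure X} [IsFiniteMeasure κ] {T : X → H}
    (hT : AEStronglyMeasurable T κ) {R : ℝ} (hR : ∀ᵐ x ∂κ, ‖T x‖ ^ 2 = R) (b : H) :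
    ENNReal.ofReal R * κ Set.univ ≤ ∫⁻ x, ENNReal.ofReal (‖T x - b‖ ^ 2) ∂κ +
      (κ Set.univ)⁻¹ * ∫⁻ x, ∫⁻ x', ‖(inner ℂ (T x) (T x') : ℂ)‖ₑ ∂κ ∂κ := by
  rcases eq_or_ne (κ Set.univ) 0 with h0 | h0
  · simp [h0]
  set l := κ.real Set.univ with hl
  have hl0 : 0 < l := ENNReal.toReal_pos h0 (measure_ne_top _ _)
  have hlk : κ Set.univ = ENNReal.ofReal l := (ENNReal.ofReal_toReal (measure_ne_top _ _)).symm
  have hR0 : 0 ≤ R := by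
    have : NeZero κ := ⟨fun h => h0 (by simp [h])⟩
    obtain ⟨x, hx⟩ := hR.exists
    rw [← hx]; positivity
  have hTi : Integrable T κ := by
    refine Integrable.of_bound hT (Real.sqrt R) ?_
    filter_upwards [hR] with x hx
    rw [← hx, Real.sqrt_sq (norm_nonneg _)]
  set V := ∫ x, T x ∂κ with hV
  have hin : Integrable (fun x => (inner ℂ b (T x) : ℂ).re) κ := (hTi.const_inner (𝕜 := ℂ) b).re
  have hexp : ∀ᵐ x ∂κ, ‖T x - b‖ ^ 2 = R - 2 * (inner ℂ b (T x) : ℂ).re + ‖b‖ ^ 2 := by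
    filter_upwards [hR] with x hx
    rw [@norm_sub_sq ℂ, hx, inner_re_symm]
    rfl
  have hint : Integrable (fun x => R - 2 * (inner ℂ b (T x) : ℂ).re + ‖b‖ ^ 2) κ :=
    ((integrable_const R).sub (hin.const_mul 2)).add (integrable_const _)
  have hval : ∫ x, (R - 2 * (inner ℂ b (T x) : ℂ).re + ‖b‖ ^ 2) ∂κ =
      R * l - 2 * (inner ℂ b V : ℂ).re + l * ‖b‖ ^ 2 := by
    rw [integral_add (by exact (integrable_const R).sub (hin.const_mul 2)) (integrable_const _),
      integral_sub (integrable_const R) (hin.const_mul 2), integral_const_mul, integral_const,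
      integral_const, smul_eq_mul, smul_eq_mul, ← hl]
    have : ∫ x, (inner ℂ b (T x) : ℂ).re ∂κ = (inner ℂ b V : ℂ).re := by
      rw [hV, ← integral_inner hTi b]
      exact integral_re (hTi.const_inner (𝕜 := ℂ) b)
    rw [this]
    ring
  have hmse : ∫⁻ x, ENNReal.ofReal (‖T x - b‖ ^ 2) ∂κ =
      ENNReal.ofReal (R * l - 2 * (inner ℂ b V : ℂ).re + l * ‖b‖ ^ 2) := by
    rw [← hval, ofReal_integral_eq_lintegral_ofReal hint]
    · exact lintegral_congr_ae (hexp.mono fun x hx => by simp only [hx])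
    · exact hexp.mono fun x hx => (sq_nonneg ‖T x - b‖).trans_eq hx
  have hsq : R * l ≤ R * l - 2 * (inner ℂ b V : ℂ).re + l * ‖b‖ ^ 2 + l⁻¹ * ‖V‖ ^ 2 := by
    have h1 : (inner ℂ b V : ℂ).re ≤ ‖b‖ * ‖V‖ :=
      (Complex.re_le_norm _).trans (norm_inner_le_norm _ _)
    have h2 : l⁻¹ * (l * ‖b‖ - ‖V‖) ^ 2 = l * ‖b‖ ^ 2 - 2 * (‖b‖ * ‖V‖) + l⁻¹ * ‖V‖ ^ 2 := by
      field_simp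
      ring
    have h3 : 0 ≤ l⁻¹ * (l * ‖b‖ - ‖V‖) ^ 2 := by positivity
    linarith
  calc ENNReal.ofReal R * κ Set.univ = ENNReal.ofReal (R * l) := by
        rw [hlk, ENNReal.ofReal_mul hR0]
    _ ≤ ENNReal.ofReal (R * l - 2 * (inner ℂ b V : ℂ).re + l * ‖b‖ ^ 2) +
        ENNReal.ofReal (l⁻¹ * ‖V‖ ^ 2) :=
        (ENNReal.ofReal_le_ofReal hsq).trans ENNReal.ofReal_add_le
    _ ≤ _ := by
        rw [hmse, ENNReal.ofReal_mul (inv_nonneg.2 hl0.le), ENNReal.ofReal_inv_of_pos hl0, ← hlk]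
        gcongr
        exact enorm_integral_sq_le hTi

/-- A Bayesian lower bound. The signal `x` has prior `μ`, the observation `y` has density `w x y`
with respect to `ν`, and `q` is a probability density of comparison. Where the marginal
density of `y` is below `ε q` the loss is at most `R ε` in total; elsewhere the normalization of the
posterior is replaced by `ε q`, so that the overlap of two posterior replicas becomes a second
moment under `q`. -/
theorem sq_norm_le_mse_add {μ : Measure X} [SFinite μ] {ν : Measure Y} [SFinite ν]
    {w : X → Y → ℝ≥0∞} (hw : Measurable (Function.uncurry w))
    (hwfin : ∀ y, ∫⁻ x, w x y ∂μ ≠ ∞) (hw1 : ∫⁻ y, ∫⁻ x, w x y ∂μ ∂ν = 1)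
    {q : Y → ℝ≥0∞} (hq : Measurable q) (hq1 : ∫⁻ y, q y ∂ν = 1)
    {T : X → H} (hT : StronglyMeasurable T) {R : ℝ} (hR : ∀ᵐ x ∂μ, ‖T x‖ ^ 2 = R)
    {N : Y → H} (hN : StronglyMeasurable N) (ε : ℝ≥0∞) :
    ENNReal.ofReal R ≤
      ∫⁻ y, ∫⁻ x, w x y * ENNReal.ofReal (‖T x - N y‖ ^ 2) ∂μ ∂ν + ENNReal.ofReal R * ε +
      ∫⁻ y, (ε * q y)⁻¹ * ∫⁻ x, ∫⁻ x', w x y * w x' y * ‖(inner ℂ (T x) (T x') : ℂ)‖ₑ ∂μ ∂μ ∂ν := by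
  have hwy : ∀ y, Measurable fun x => w x y := fun y => hw.comp measurable_prodMk_right
  have hl : Measurable fun y => ∫⁻ x, w x y ∂μ := hw.lintegral_prod_left
  have hm1 : Measurable fun y => ∫⁻ x, w x y * ENNReal.ofReal (‖T x - N y‖ ^ 2) ∂μ := by
    refine Measurable.lintegral_prod_left' (f := fun p : X × Y =>
      w p.1 p.2 * ENNReal.ofReal (‖T p.1 - N p.2‖ ^ 2)) (hw.mul ?_)
    exact ((((hT.comp_measurable measurable_fst).sub
      (hN.comp_measurable measurable_snd)).norm.measurable.pow_const 2)).ennreal_ofReal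
  have key : ∀ y, ENNReal.ofReal R * ∫⁻ x, w x y ∂μ ≤
      ∫⁻ x, w x y * ENNReal.ofReal (‖T x - N y‖ ^ 2) ∂μ + ENNReal.ofReal R * (ε * q y) +
      (ε * q y)⁻¹ * ∫⁻ x, ∫⁻ x', w x y * w x' y * ‖(inner ℂ (T x) (T x') : ℂ)‖ₑ ∂μ ∂μ := by
    intro y
    rcases le_total (ε * q y) (∫⁻ x, w x y ∂μ) with hy | hy
    · have hfin : IsFiniteMeasure (μ.withDensity fun x => w x y) :=
        isFiniteMeasure_withDensity (hwfin y)
      have huniv : (μ.withDensity fun x => w x y) Set.univ = ∫⁻ x, w x y ∂μ := by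
        rw [withDensity_apply _ MeasurableSet.univ, Measure.restrict_univ]
      have h := sq_norm_mul_measure_le (κ := μ.withDensity fun x => w x y)
        hT.aestronglyMeasurable ((withDensity_absolutelyContinuous _ _).ae_le hR) (N y)
      have hmT : Measurable fun x => ENNReal.ofReal (‖T x - N y‖ ^ 2) :=
        ((hT.sub stronglyMeasurable_const).norm.measurable.pow_const 2).ennreal_ofReal
      have hmi : Measurable fun p : X × X => ‖(inner ℂ (T p.1) (T p.2) : ℂ)‖ₑ :=
        ((hT.comp_measurable measurable_fst).inner (hT.comp_measurable measurable_snd)).enorm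
      have hmi' : ∀ x, Measurable fun x' => ‖(inner ℂ (T x) (T x') : ℂ)‖ₑ := fun x =>
        hmi.comp measurable_prodMk_left
      rw [huniv, lintegral_withDensity_eq_lintegral_mul _ (hwy y) hmT,
        lintegral_withDensity_eq_lintegral_mul _ (hwy y)
          (by exact
            (Measurable.lintegral_prod_right' (ν := μ.withDensity fun x => w x y) hmi))] at h
      refine h.trans ?_
      rw [add_assoc]
      refine add_le_add le_rfl (le_add_left (mul_le_mul' (ENNReal.inv_le_inv.2 hy) ?_))
      refine lintegral_mono fun x => ?_
      rw [Pi.mul_apply, lintegral_withDensity_eq_lintegral_mul _ (hwy y) (hmi' x),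
        ← lintegral_const_mul _ ((hwy y).mul (hmi' x))]
      simp [mul_assoc]
    · exact (mul_le_mul' le_rfl hy).trans (le_add_right le_add_self)
  have hmq : Measurable fun y => ENNReal.ofReal R * (ε * q y) := (hq.const_mul _).const_mul _
  calc ENNReal.ofReal R = ∫⁻ y, ENNReal.ofReal R * ∫⁻ x, w x y ∂μ ∂ν := by
        rw [lintegral_const_mul _ hl, hw1, mul_one]
    _ ≤ _ := lintegral_mono key
    _ = _ := by
        rw [lintegral_add_left (by exact hm1.add hmq), lintegral_add_left hm1,
          lintegral_const_mul _ (hq.const_mul _), lintegral_const_mul _ hq, hq1, mul_one]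

end Bayes

/-! ### The phase retrieval channel -/

lemma lintegral_pi_prod {α : Type*} [MeasurableSpace α] {μ : Measure α} [SigmaFinite μ] {n : ℕ}
    {f : Fin n → α → ℝ≥0∞} (hf : ∀ i, Measurable (f i)) :
    ∫⁻ x, ∏ i, f i (x i) ∂(Measure.pi fun _ : Fin n => μ) = ∏ i, ∫⁻ a, f i a ∂μ := by
  induction n with
  | zero => simp
  | succ n ih =>
    rw [← ((measurePreserving_piFinSuccAbove (fun _ : Fin (n + 1) => μ) 0).symm).lintegral_comp
      (by fun_prop), Fin.prod_univ_succ, ← ih fun i => hf i.succ,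
      ← lintegral_prod_mul (hf 0).aemeasurable (Finset.measurable_fun_prod _ fun i _ =>
        (hf i.succ).comp (measurable_pi_apply i)).aemeasurable]
    simp_rw [MeasurableEquiv.piFinSuccAbove_symm_apply, Fin.insertNthEquiv,
      Fin.prod_univ_succ, Fin.insertNth_zero, Equiv.coe_fn_mk, Fin.cons_succ, Fin.cons_zero]
    rfl

lemma lintegral_replica_swap {X Y : Type*} [MeasurableSpace X] [MeasurableSpace Y]
    {μ : Measure X} {ν : Measure Y} [SFinite μ] [SFinite ν] {L : X → Y → ℝ≥0∞} {q : Y → ℝ≥0∞}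
    {c : X → X → ℝ≥0∞} (hL : Measurable (Function.uncurry L)) (hq : Measurable q)
    (hc : Measurable (Function.uncurry c)) :
    ∫⁻ y, q y * ∫⁻ x, ∫⁻ x', L x y * L x' y * c x x' ∂μ ∂μ ∂ν =
      ∫⁻ x, ∫⁻ x', (∫⁻ y, q y * (L x y * L x' y) ∂ν) * c x x' ∂μ ∂μ := by
  have hm : Measurable fun t : (Y × X) × X => q t.1.1 * (L t.1.2 t.1.1 * L t.2 t.1.1 *
      c t.1.2 t.2) :=
    (hq.comp measurable_fst.fst).mul (((hL.comp (measurable_fst.snd.prodMk measurable_fst.fst)).mul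
      (hL.comp (measurable_snd.prodMk measurable_fst.fst))).mul
      (hc.comp (measurable_fst.snd.prodMk measurable_snd)))
  have hm0 : ∀ y, Measurable fun t : X × X => L t.1 y * L t.2 y * c t.1 t.2 := fun y =>
    ((hL.comp (measurable_fst.prodMk measurable_const)).mul
      (hL.comp (measurable_snd.prodMk measurable_const))).mul hc
  have hm1 : ∀ x, Measurable fun t : Y × X => q t.1 * (L x t.1 * L t.2 t.1 * c x t.2) := fun x =>
    hm.comp (measurable_fst.prodMk measurable_const |>.prodMk measurable_snd)
  have hm2 : ∀ x x', Measurable fun y => q y * (L x y * L x' y) := fun x x' =>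
    hq.mul ((hL.comp measurable_prodMk_left).mul (hL.comp measurable_prodMk_left))
  have e : ∀ y, q y * ∫⁻ x, ∫⁻ x', L x y * L x' y * c x x' ∂μ ∂μ =
      ∫⁻ x, ∫⁻ x', q y * (L x y * L x' y * c x x') ∂μ ∂μ := by
    intro y
    rw [← lintegral_const_mul _ (hm0 y).lintegral_prod_right']
    exact lintegral_congr fun x =>
      (lintegral_const_mul _ ((hm0 y).comp measurable_prodMk_left)).symm
  simp_rw [e]
  rw [lintegral_lintegral_swap (by exact hm.lintegral_prod_right'.aemeasurable)]
  refine lintegral_congr fun x => ?_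
  rw [lintegral_lintegral_swap (by exact (hm1 x).aemeasurable)]
  refine lintegral_congr fun x' => ?_
  simp_rw [← mul_assoc _ _ (c x x')]
  exact lintegral_mul_const _ (hm2 x x')

section Channel

variable {σ : ℝ}

@[fun_prop]
lemma continuous_pPR (σ : ℝ) : Continuous fun p : ℝ × ℝ => pPR σ p.1 p.2 := by
  unfold pPR; fun_prop

lemma pPR_pos (hσ : 0 < σ) (y r : ℝ) : 0 < pPR σ y r := by
  unfold pPR; positivity

lemma pPR_le (hσ : 0 < σ) (y r : ℝ) : pPR σ y r ≤ 1 / (σ * Real.sqrt (2 * Real.pi)) := by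
  unfold pPR
  refine mul_le_of_le_one_right (by positivity) (Real.exp_le_one_iff.2 ?_)
  rw [neg_div]
  exact neg_nonpos.2 (by positivity)

lemma lintegral_pPR (hσ : 0 < σ) (r : ℝ) : ∫⁻ y, ENNReal.ofReal (pPR σ y r) = 1 := by
  have hv : (Real.toNNReal (σ ^ 2)) ≠ 0 := by
    rw [Ne, Real.toNNReal_eq_zero, not_le]
    positivity
  rw [← lintegral_gaussianPDFReal_eq_one (r ^ 2) hv]
  refine lintegral_congr fun y => ?_
  simp only [pPR, gaussianPDFReal]
  rw [Real.coe_toNNReal _ (sq_nonneg σ), mul_comm (2 * Real.pi), Real.sqrt_mul (sq_nonneg σ),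
    Real.sqrt_sq hσ.le, one_div]

/-- The density of a single measurement when the signal is ignored, that is, when the scalar
product of signal and sensing vector is replaced by a standard complex normal. -/
def nullDensity (σ y : ℝ) : ℝ≥0∞ := ∫⁻ g, ENNReal.ofReal (pPR σ y ‖g‖) ∂(complexNormal 1)

@[fun_prop]
lemma measurable_nullDensity (σ : ℝ) : Measurable (nullDensity σ) :=
  Measurable.lintegral_prod_right' (f := fun p : ℝ × ℂ => ENNReal.ofReal (pPR σ p.1 ‖p.2‖))
    (by fun_prop)

lemma nullDensity_ne_zero (hσ : 0 < σ) (y : ℝ) : nullDensity σ y ≠ 0 := by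
  rw [nullDensity, Ne, lintegral_eq_zero_iff (by fun_prop)]
  intro h
  obtain ⟨g, hg⟩ := h.exists
  exact (ENNReal.ofReal_pos.2 (pPR_pos hσ y ‖g‖)).ne' hg

lemma nullDensity_ne_top (hσ : 0 < σ) (y : ℝ) : nullDensity σ y ≠ ∞ := by
  have h : nullDensity σ y ≤
      ∫⁻ _, ENNReal.ofReal (1 / (σ * Real.sqrt (2 * Real.pi))) ∂(complexNormal 1) :=
    lintegral_mono fun g => ENNReal.ofReal_le_ofReal (pPR_le hσ y ‖g‖)
  rw [lintegral_const, measure_univ, mul_one] at h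
  exact ne_top_of_le_ne_top ENNReal.ofReal_ne_top h

lemma lintegral_nullDensity (hσ : 0 < σ) : ∫⁻ y, nullDensity σ y = 1 := by
  unfold nullDensity
  rw [lintegral_lintegral_swap (by fun_prop)]
  simp [lintegral_pPR hσ]

/-- The second moment, under the null density, of the likelihood ratios of two signals whose
scalar products with the sensing vector are `g` and `g'`. -/
def overlapKernel (σ : ℝ) (g g' : ℂ) : ℝ≥0∞ :=
  ∫⁻ y, (nullDensity σ y)⁻¹ * (ENNReal.ofReal (pPR σ y ‖g‖) * ENNReal.ofReal (pPR σ y ‖g'‖))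

lemma measurable_overlapKernel (σ : ℝ) : Measurable (Function.uncurry (overlapKernel σ)) :=
  Measurable.lintegral_prod_right' (f := fun p : (ℂ × ℂ) × ℝ => (nullDensity σ p.2)⁻¹ *
    (ENNReal.ofReal (pPR σ p.2 ‖p.1.1‖) * ENNReal.ofReal (pPR σ p.2 ‖p.1.2‖))) (by fun_prop)

lemma lintegral_overlapKernel (hσ : 0 < σ) (g : ℂ) :
    ∫⁻ g', overlapKernel σ g g' ∂(complexNormal 1) = 1 := by
  unfold overlapKernel
  rw [lintegral_lintegral_swap (by fun_prop), ← lintegral_pPR hσ ‖g‖]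
  refine lintegral_congr fun y => ?_
  simp_rw [← mul_assoc]
  rw [lintegral_const_mul _ (by fun_prop), ← nullDensity, mul_right_comm,
    ENNReal.inv_mul_cancel (nullDensity_ne_zero hσ y) (nullDensity_ne_top hσ y), one_mul]

lemma lintegral_overlapKernel_sensingLaw_le (hσ : 0 < σ) {d : ℕ} (hd : 0 < d) {x x' : Sig d}
    (hx : ‖x‖ ^ 2 = d) (hx' : ‖x'‖ ^ 2 = d) :
    ∫⁻ a, overlapKernel σ (inner ℂ a x) (inner ℂ a x') ∂(sensingLaw d) ≤
      (ENNReal.ofReal (1 - ‖(inner ℂ x x' : ℂ)‖ ^ 2 / (d : ℝ) ^ 2))⁻¹ := by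
  have hd0 : (d : ℝ) ≠ 0 := by positivity
  set c : ℂ := inner ℂ x x' / d with hc
  have hcn : ‖(inner ℂ x x' : ℂ)‖ ^ 2 / (d : ℝ) ^ 2 = ‖c‖ ^ 2 := by
    rw [hc, norm_div, div_pow, Complex.norm_natCast]
  rw [hcn]
  rcases le_or_gt (1 - ‖c‖ ^ 2) 0 with h0 | h0
  · simp [ENNReal.ofReal_of_nonpos h0]
  have hs2 : Real.sqrt (1 - ‖c‖ ^ 2) ^ 2 = 1 - ‖c‖ ^ 2 := Real.sq_sqrt h0.le
  have hcs : ‖c‖ ^ 2 + Real.sqrt (1 - ‖c‖ ^ 2) ^ 2 = 1 := by rw [hs2]; ring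
  have hmap := map_inner_sensingLaw hd hx hx'
    (c := c) (by rw [hc, mul_div_cancel₀]; exact_mod_cast hd0) hcs
  have hK := measurable_overlapKernel σ
  calc ∫⁻ a, overlapKernel σ (inner ℂ a x) (inner ℂ a x') ∂(sensingLaw d)
      = ∫⁻ p, Function.uncurry (overlapKernel σ) p
          ∂((sensingLaw d).map fun a => ((inner ℂ a x : ℂ), (inner ℂ a x' : ℂ))) := by
        rw [lintegral_map hK (by fun_prop)]; rfl
    _ = ∫⁻ g, ∫⁻ g', overlapKernel σ g (c * g + Real.sqrt (1 - ‖c‖ ^ 2) * g')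
          ∂(complexNormal 1) ∂(complexNormal 1) := by
        rw [hmap, lintegral_map hK (by fun_prop),
          lintegral_prod _ (by exact (hK.comp (by fun_prop)).aemeasurable)]
        rfl
    _ ≤ ENNReal.ofReal (1 - ‖c‖ ^ 2)⁻¹ :=
        lintegral_correlated_pair_le hK
          (fun g g' => by simp only [overlapKernel, mul_comm (ENNReal.ofReal (pPR σ _ ‖g‖))])
          (fun θ g g' => by simp [overlapKernel, Complex.norm_exp_ofReal_mul_I])
          (lintegral_overlapKernel hσ) (Real.sqrt_pos.2 h0) hcs
    _ = _ := ENNReal.ofReal_inv_of_pos h0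

end Channel

section Model

variable {d n : ℕ} {σ : ℝ}

/-- The reference measure for the observations: the sensing vectors have their true law, the
measurements Lebesgue measure. -/
def obsMeasure (d n : ℕ) : Measure ((Fin n → Sig d) × (Fin n → ℝ)) :=
  (Measure.pi fun _ : Fin n => sensingLaw d).prod volume

instance sfinite_obsMeasure (d n : ℕ) : SFinite (obsMeasure d n) := by
  unfold obsMeasure
  have h1 : SFinite (Measure.pi fun _ : Fin n => sensingLaw d) := inferInstance
  have h2 : SFinite (volume : Measure (Fin n → ℝ)) := inferInstance
  infer_instance

/-- The likelihood of the signal `x` given the observations. -/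
def likelihood (σ : ℝ) (x : Sig d) (o : (Fin n → Sig d) × (Fin n → ℝ)) : ℝ≥0∞ :=
  ∏ i, ENNReal.ofReal (pPR σ (o.2 i) ‖(inner ℂ (o.1 i) x : ℂ)‖)

/-- The density of the observations under the null model. -/
def nullObsDensity (σ : ℝ) (o : (Fin n → Sig d) × (Fin n → ℝ)) : ℝ≥0∞ := ∏ i, nullDensity σ (o.2 i)

lemma measurable_likelihood (σ : ℝ) : Measurable (Function.uncurry
    (likelihood σ : Sig d → (Fin n → Sig d) × (Fin n → ℝ) → ℝ≥0∞)) := by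
  unfold likelihood Function.uncurry; fun_prop

lemma measurable_nullObsDensity (σ : ℝ) :
    Measurable (nullObsDensity σ : (Fin n → Sig d) × (Fin n → ℝ) → ℝ≥0∞) := by
  unfold nullObsDensity; fun_prop

/-- Integrals over the observations factorize over the measurements. -/
lemma lintegral_obsMeasure_prod {f : Sig d → ℝ → ℝ≥0∞}
    (hf : Measurable (Function.uncurry f)) :
    ∫⁻ o, ∏ i, f (o.1 i) (o.2 i) ∂(obsMeasure d n) =
      (∫⁻ a, (∫⁻ y, f a y) ∂(sensingLaw d)) ^ n := by
  have hfa : ∀ a, Measurable (f a) := fun a => hf.comp measurable_prodMk_left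
  have hm : Measurable fun o : (Fin n → Sig d) × (Fin n → ℝ) => ∏ i, f (o.1 i) (o.2 i) :=
    Finset.measurable_fun_prod _ fun i _ => hf.comp (by fun_prop :
      Measurable fun o : (Fin n → Sig d) × (Fin n → ℝ) => (o.1 i, o.2 i))
  rw [obsMeasure, lintegral_prod _ hm.aemeasurable]
  simp_rw [volume_pi, lintegral_pi_prod fun i : Fin n => hfa _]
  rw [lintegral_pi_prod fun i : Fin n => hf.lintegral_prod_right]
  simp

lemma lintegral_likelihood_obsMeasure (hσ : 0 < σ) (x : Sig d) :
    ∫⁻ o, likelihood σ x o ∂(obsMeasure d n) = 1 := by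
  unfold likelihood
  rw [lintegral_obsMeasure_prod (f := fun a y => ENNReal.ofReal (pPR σ y ‖(inner ℂ a x : ℂ)‖))
    (by unfold Function.uncurry; fun_prop)]
  simp [lintegral_pPR hσ]

lemma lintegral_nullObsDensity (hσ : 0 < σ) :
    ∫⁻ o, nullObsDensity σ o ∂(obsMeasure d n) = 1 := by
  unfold nullObsDensity
  rw [lintegral_obsMeasure_prod (f := fun _ y => nullDensity σ y)
    (by unfold Function.uncurry; fun_prop)]
  simp [lintegral_nullDensity hσ]

lemma lintegral_likelihood_ne_top (hσ : 0 < σ) (hd : 0 < d)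
    (o : (Fin n → Sig d) × (Fin n → ℝ)) : ∫⁻ x, likelihood σ x o ∂(unifSphere d) ≠ ∞ := by
  have := isProbabilityMeasure_unifSphere hd
  have h : ∫⁻ x, likelihood σ x o ∂(unifSphere d) ≤
      ∫⁻ _, ∏ _i : Fin n, ENNReal.ofReal (1 / (σ * Real.sqrt (2 * Real.pi))) ∂(unifSphere d) :=
    lintegral_mono fun x => Finset.prod_le_prod' fun i _ =>
      ENNReal.ofReal_le_ofReal (pPR_le hσ _ _)
  rw [lintegral_const, measure_univ, mul_one] at h
  exact ne_top_of_le_ne_top (ENNReal.prod_ne_top fun i _ => ENNReal.ofReal_ne_top) h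

lemma lintegral_likelihood (hσ : 0 < σ) (hd : 0 < d) :
    ∫⁻ o, ∫⁻ x, likelihood σ x o ∂(unifSphere d) ∂(obsMeasure d n) = 1 := by
  have := isProbabilityMeasure_unifSphere hd
  rw [lintegral_lintegral_swap
    (by exact ((measurable_likelihood σ).comp measurable_swap).aemeasurable)]
  simp [lintegral_likelihood_obsMeasure hσ]

/-- The second moment of the likelihood ratio at a pair of signals is controlled by their
overlap. -/
lemma lintegral_likelihood_mul_le (hσ : 0 < σ) (hd : 0 < d) {x x' : Sig d}
    (hx : ‖x‖ ^ 2 = d) (hx' : ‖x'‖ ^ 2 = d) :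
    ∫⁻ o, (nullObsDensity σ o)⁻¹ * (likelihood σ x o * likelihood σ x' o) ∂(obsMeasure d n) ≤
      (ENNReal.ofReal (1 - ‖(inner ℂ x x' : ℂ)‖ ^ 2 / (d : ℝ) ^ 2))⁻¹ ^ n := by
  have e : ∀ o : (Fin n → Sig d) × (Fin n → ℝ),
      (nullObsDensity σ o)⁻¹ * (likelihood σ x o * likelihood σ x' o) =
      ∏ i, (nullDensity σ (o.2 i))⁻¹ * (ENNReal.ofReal (pPR σ (o.2 i) ‖(inner ℂ (o.1 i) x : ℂ)‖) *
        ENNReal.ofReal (pPR σ (o.2 i) ‖(inner ℂ (o.1 i) x' : ℂ)‖)) := by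
    intro o
    rw [nullObsDensity, likelihood, likelihood, Finset.prod_mul_distrib, Finset.prod_mul_distrib,
      ENNReal.prod_inv_distrib fun i _ j _ _ => Or.inl (nullDensity_ne_zero hσ _)]
  simp_rw [e]
  rw [lintegral_obsMeasure_prod (f := fun a y => (nullDensity σ y)⁻¹ *
    (ENNReal.ofReal (pPR σ y ‖(inner ℂ a x : ℂ)‖) *
      ENNReal.ofReal (pPR σ y ‖(inner ℂ a x' : ℂ)‖))) (by unfold Function.uncurry; fun_prop)]
  exact pow_le_pow_left' (lintegral_overlapKernel_sensingLaw_le hσ hd hx hx') n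

/-- The expected squared overlap of two replicas under the null model is of order `1 / d`. -/
lemma lintegral_replica_overlap_le (hσ : 0 < σ) {p : ℕ} (hd : d = n + p + 2) :
    ∫⁻ o, (nullObsDensity σ o)⁻¹ * ∫⁻ x, ∫⁻ x', likelihood σ x o * likelihood σ x' o *
        ENNReal.ofReal (‖(inner ℂ x x' : ℂ)‖ ^ 2) ∂(unifSphere d) ∂(unifSphere d)
        ∂(obsMeasure d n) ≤
      ENNReal.ofReal ((d : ℝ) ^ 2) *
        ENNReal.ofReal ((n + p + 1) / ((p + 2) * (p + 1))) := by
  have hd0 : 0 < d := by omega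
  have hdr : (0 : ℝ) < (d : ℝ) ^ 2 := by positivity
  have := isProbabilityMeasure_unifSphere hd0
  calc _ = ∫⁻ x, ∫⁻ x', (∫⁻ o, (nullObsDensity σ o)⁻¹ * (likelihood σ x o * likelihood σ x' o)
        ∂(obsMeasure d n)) * ENNReal.ofReal (‖(inner ℂ x x' : ℂ)‖ ^ 2)
        ∂(unifSphere d) ∂(unifSphere d) :=
        lintegral_replica_swap (measurable_likelihood σ) (measurable_nullObsDensity σ).inv
          (by fun_prop)
    _ ≤ ∫⁻ x, ENNReal.ofReal ((d : ℝ) ^ 2) *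
          ENNReal.ofReal ((n + p + 1) / ((p + 2) * (p + 1))) ∂(unifSphere d) := by
        refine lintegral_mono_ae ?_
        filter_upwards [ae_norm_sq_unifSphere d] with x hx
        rw [← lintegral_overlap_unifSphere hd hx, ← lintegral_const_mul _ (by fun_prop)]
        refine lintegral_mono_ae ?_
        filter_upwards [ae_norm_sq_unifSphere d] with x' hx'
        rw [← mul_assoc, ← ENNReal.ofReal_mul hdr.le, mul_div_cancel₀ _ hdr.ne', mul_comm]
        gcongr
        exact lintegral_likelihood_mul_le hσ hd0 hx hx'
    _ = _ := by rw [lintegral_const, measure_univ, mul_one]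

end Model

/-! ### Bounds on the minimum mean square error -/

/-- A conditional expectation is at least as good an estimator as zero, in mean square. -/
lemma lintegral_sub_condExp_sq_le {Ω : Type*} {m m₀ : MeasurableSpace Ω} {P : Measure Ω}
    [IsFiniteMeasure P] (hm : m ≤ m₀) {f : Ω → ℂ} (hf : MemLp f 2 P) :
    ∫⁻ ω, ENNReal.ofReal (‖f ω - (P[f | m]) ω‖ ^ 2) ∂P ≤
      ∫⁻ ω, ENNReal.ofReal (‖f ω‖ ^ 2) ∂P := by
  have : Fact (m ≤ m₀) := ⟨hm⟩
  have h1 : ‖hf.toLp f - (condExpL2 ℂ ℂ hm (hf.toLp f) : Lp ℂ 2 P)‖ ≤ ‖hf.toLp f‖ := by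
    have h := (lpMeas ℂ ℂ m 2 P)ᗮ.norm_starProjection_apply_le (hf.toLp f)
    rwa [Submodule.starProjection_orthogonal] at h
  have h2 : (hf.toLp f - (condExpL2 ℂ ℂ hm (hf.toLp f) : Lp ℂ 2 P) : Lp ℂ 2 P) =ᵐ[P]
      fun ω => f ω - (P[f | m]) ω := by
    filter_upwards [Lp.coeFn_sub (hf.toLp f) (condExpL2 ℂ ℂ hm (hf.toLp f) : Lp ℂ 2 P),
      hf.coeFn_toLp, hf.condExpL2_ae_eq_condExp (𝕜 := ℂ) hm] with ω h3 h4 h5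
    rw [h3, Pi.sub_apply, h4, h5]
  have h3 : eLpNorm (fun ω => f ω - (P[f | m]) ω) 2 P ≤ eLpNorm f 2 P := by
    rw [← eLpNorm_congr_ae h2, ← eLpNorm_congr_ae hf.coeFn_toLp]
    rw [Lp.norm_def, Lp.norm_def] at h1
    exact (ENNReal.toReal_le_toReal (Lp.eLpNorm_ne_top _) (Lp.eLpNorm_ne_top _)).1 h1
  have h4 : ∀ g : Ω → ℂ, ∫⁻ ω, ENNReal.ofReal (‖g ω‖ ^ 2) ∂P = eLpNorm g 2 P ^ 2 := by
    intro g
    have := eLpNorm_nnreal_pow_eq_lintegral (f := g) (μ := P) (p := 2) two_ne_zero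
    simp only [NNReal.coe_ofNat, ENNReal.rpow_ofNat, ENNReal.coe_ofNat] at this
    rw [this]
    refine lintegral_congr fun ω => ?_
    rw [ENNReal.ofReal_pow (norm_nonneg _), ofReal_norm]
  rw [h4, h4]
  exact pow_le_pow_left' h3 2

section Error

variable {d n : ℕ} {σ : ℝ}

/-- The matrix `x x^*` as a vector of the Hilbert space of matrices with the Frobenius norm. -/
def outerVec (x : Sig d) : EuclideanSpace ℂ (Fin d × Fin d) :=
  WithLp.toLp 2 fun p => x p.1 * star (x p.2)

lemma continuous_outerVec : Continuous (outerVec : Sig d → _) := by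
  unfold outerVec; fun_prop

lemma inner_outerVec (x x' : Sig d) :
    (inner ℂ (outerVec x) (outerVec x') : ℂ) = inner ℂ x x' * starRingEnd ℂ (inner ℂ x x') := by
  simp only [outerVec, PiLp.inner_apply, Fintype.sum_prod_type, map_sum, Finset.sum_mul_sum]
  refine Finset.sum_congr rfl fun i _ => Finset.sum_congr rfl fun j _ => ?_
  simp
  ring

lemma enorm_inner_outerVec (x x' : Sig d) :
    ‖(inner ℂ (outerVec x) (outerVec x') : ℂ)‖ₑ =
      ENNReal.ofReal (‖(inner ℂ x x' : ℂ)‖ ^ 2) := by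
  rw [inner_outerVec, ← ofReal_norm, norm_mul, RCLike.norm_conj, sq]

lemma norm_sq_outerVec (x : Sig d) : ‖outerVec x‖ ^ 2 = (‖x‖ ^ 2) ^ 2 := by
  have h := inner_outerVec x x
  rw [inner_self_eq_norm_sq_to_K, inner_self_eq_norm_sq_to_K] at h
  have h2 := congrArg Complex.re h
  simp only [map_pow, Complex.conj_ofReal, Complex.coe_algebraMap] at h2
  norm_cast at h2
  rw [h2]
  ring

lemma frobeniusSq_outer_sub (ω : Sig d × (Fin n → Sig d) × (Fin n → ℝ))
    (M : Matrix (Fin d) (Fin d) ℂ) :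
    frobeniusSq (outer ω - M) = ‖outerVec ω.1 - WithLp.toLp 2 fun p => M p.1 p.2‖ ^ 2 := by
  rw [EuclideanSpace.norm_sq_eq, Fintype.sum_prod_type]
  rfl

lemma lintegral_jointLaw {f : Sig d × (Fin n → Sig d) × (Fin n → ℝ) → ℝ≥0∞} (hσ : 0 < σ)
    (hd : 0 < d) (hf : Measurable f) :
    ∫⁻ ω, f ω ∂(jointLaw d n σ) =
      ∫⁻ o, ∫⁻ x, likelihood σ x o * f (x, o) ∂(unifSphere d) ∂(obsMeasure d n) := by
  have := isProbabilityMeasure_unifSphere hd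
  have e : ∀ ω : Sig d × (Fin n → Sig d) × (Fin n → ℝ),
      ENNReal.ofReal (∏ i : Fin n, pPR σ (ω.2.2 i) ‖(inner ℂ (ω.2.1 i) ω.1 : ℂ)‖) =
        likelihood σ ω.1 ω.2 := fun ω =>
    ENNReal.ofReal_prod_of_nonneg fun i _ => (pPR_pos hσ _ _).le
  have hL : Measurable fun ω : Sig d × (Fin n → Sig d) × (Fin n → ℝ) => likelihood σ ω.1 ω.2 :=
    measurable_likelihood σ
  rw [jointLaw, ← obsMeasure]
  simp_rw [e]
  rw [lintegral_withDensity_eq_lintegral_mul _ hL hf]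
  exact lintegral_prod_symm _ (hL.mul hf).aemeasurable

lemma isProbabilityMeasure_jointLaw (hσ : 0 < σ) (hd : 0 < d) :
    IsProbabilityMeasure (jointLaw d n σ) := by
  constructor
  rw [← lintegral_one, lintegral_jointLaw hσ hd measurable_const]
  simp [lintegral_likelihood hσ hd]

lemma ae_norm_sq_jointLaw (hd : 0 < d) : ∀ᵐ ω ∂(jointLaw d n σ), ‖ω.1‖ ^ 2 = d := by
  have := isProbabilityMeasure_unifSphere hd
  refine (withDensity_absolutelyContinuous _ _).ae_le ?_
  rw [← obsMeasure]
  exact Measure.quasiMeasurePreserving_fst.ae (ae_norm_sq_unifSphere d)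

lemma observed_le (d n : ℕ) : observed d n ≤ Prod.instMeasurableSpace := measurable_snd.comap_le

lemma memLp_outer (hσ : 0 < σ) (hd : 0 < d) (i j : Fin d) :
    MemLp (fun ω => outer ω i j) 2 (jointLaw d n σ) := by
  have := isProbabilityMeasure_jointLaw (n := n) hσ hd
  refine MemLp.of_bound (C := d) ?_ ?_
  · refine Measurable.aestronglyMeasurable ?_
    simp only [outer, Matrix.vecMulVec_apply, Pi.star_apply]
    fun_prop
  · filter_upwards [ae_norm_sq_jointLaw hd] with ω hω
    rw [← hω, sq, outer, Matrix.vecMulVec_apply, norm_mul, Pi.star_apply, norm_star]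
    exact mul_le_mul (PiLp.norm_apply_le ω.1 i) (PiLp.norm_apply_le ω.1 j) (norm_nonneg _)
      (norm_nonneg _)

lemma memLp_posteriorMean (hσ : 0 < σ) (hd : 0 < d) (i j : Fin d) :
    MemLp (fun ω => posteriorMean d n σ ω i j) 2 (jointLaw d n σ) :=
  (memLp_outer hσ hd i j).condExp one_le_two

lemma integrable_frobeniusSq (hσ : 0 < σ) (hd : 0 < d) :
    Integrable (fun ω => frobeniusSq (outer ω - posteriorMean d n σ ω)) (jointLaw d n σ) := by
  unfold frobeniusSq
  refine integrable_finsetSum _ fun i _ => integrable_finsetSum _ fun j _ => ?_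
  exact ((memLp_outer hσ hd i j).sub (memLp_posteriorMean hσ hd i j)).integrable_norm_pow
    two_ne_zero

lemma frobeniusSq_nonneg (M : Matrix (Fin d) (Fin d) ℂ) : 0 ≤ frobeniusSq M := by
  unfold frobeniusSq; positivity

lemma mmsePR_nonneg : 0 ≤ mmsePR d n σ :=
  mul_nonneg (by positivity) (integral_nonneg fun _ => frobeniusSq_nonneg _)

lemma lintegral_frobeniusSq (hσ : 0 < σ) (hd : 0 < d) :
    ∫⁻ ω, ENNReal.ofReal (frobeniusSq (outer ω - posteriorMean d n σ ω)) ∂(jointLaw d n σ) =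
      ENNReal.ofReal ((d : ℝ) ^ 2 * mmsePR d n σ) := by
  rw [← ofReal_integral_eq_lintegral_ofReal (integrable_frobeniusSq hσ hd)
    (Eventually.of_forall fun ω => frobeniusSq_nonneg _), mmsePR, ← mul_assoc,
    mul_one_div_cancel (by positivity), one_mul]

lemma mmsePR_le_one (hσ : 0 < σ) (hd : 0 < d) : mmsePR d n σ ≤ 1 := by
  have := isProbabilityMeasure_jointLaw (n := n) hσ hd
  have hdr : (0 : ℝ) < (d : ℝ) ^ 2 := by positivity
  have hsum : ∀ M : Sig d × (Fin n → Sig d) × (Fin n → ℝ) → Matrix (Fin d) (Fin d) ℂ,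
      (∀ i j, MemLp (fun ω => M ω i j) 2 (jointLaw d n σ)) →
      ∫⁻ ω, ENNReal.ofReal (frobeniusSq (M ω)) ∂(jointLaw d n σ) =
        ∑ i, ∑ j, ∫⁻ ω, ENNReal.ofReal (‖M ω i j‖ ^ 2) ∂(jointLaw d n σ) := by
    intro M hM
    have hm : ∀ i j, AEMeasurable (fun ω => ENNReal.ofReal (‖M ω i j‖ ^ 2)) (jointLaw d n σ) :=
      fun i j => ((hM i j).aestronglyMeasurable.norm.aemeasurable.pow_const 2).ennreal_ofReal
    have e : ∀ ω, ENNReal.ofReal (frobeniusSq (M ω)) =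
        ∑ i, ∑ j, ENNReal.ofReal (‖M ω i j‖ ^ 2) := by
      intro ω
      rw [frobeniusSq, ENNReal.ofReal_sum_of_nonneg fun i _ => by positivity]
      exact Finset.sum_congr rfl fun i _ => ENNReal.ofReal_sum_of_nonneg fun j _ => by positivity
    simp_rw [e]
    rw [lintegral_finsetSum' _ fun i _ => Finset.aemeasurable_fun_sum _ fun j _ => hm i j]
    exact Finset.sum_congr rfl fun i _ => lintegral_finsetSum' _ fun j _ => hm i j
  have h : ENNReal.ofReal ((d : ℝ) ^ 2 * mmsePR d n σ) ≤ ENNReal.ofReal ((d : ℝ) ^ 2) := by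
    rw [← lintegral_frobeniusSq hσ hd, hsum (fun ω => outer ω - posteriorMean d n σ ω) fun i j =>
      (memLp_outer hσ hd i j).sub (memLp_posteriorMean hσ hd i j)]
    calc _ ≤ ∑ i, ∑ j, ∫⁻ ω, ENNReal.ofReal (‖outer ω i j‖ ^ 2) ∂(jointLaw d n σ) :=
          Finset.sum_le_sum fun i _ => Finset.sum_le_sum fun j _ =>
            lintegral_sub_condExp_sq_le (observed_le d n) (memLp_outer hσ hd i j)
      _ = ∫⁻ ω, ENNReal.ofReal (frobeniusSq (outer ω)) ∂(jointLaw d n σ) :=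
          (hsum _ fun i j => memLp_outer hσ hd i j).symm
      _ = ∫⁻ _, ENNReal.ofReal ((d : ℝ) ^ 2) ∂(jointLaw d n σ) := by
          refine lintegral_congr_ae ?_
          filter_upwards [ae_norm_sq_jointLaw hd] with ω hω
          have h := frobeniusSq_outer_sub ω 0
          rw [sub_zero] at h
          rw [h, ← hω, ← norm_sq_outerVec]
          congr 3
          exact sub_zero _
      _ = _ := by rw [lintegral_const, measure_univ, mul_one]
  have h2 := (ENNReal.ofReal_le_ofReal_iff hdr.le).1 h
  exact le_of_mul_le_mul_left (by linarith) hdr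

/-- The posterior mean as a function of the observations alone. -/
lemma exists_measurable_posteriorMean (d n : ℕ) (σ : ℝ) :
    ∃ N : (Fin n → Sig d) × (Fin n → ℝ) → EuclideanSpace ℂ (Fin d × Fin d), StronglyMeasurable N ∧
      ∀ ω, (WithLp.toLp 2 fun p : Fin d × Fin d => posteriorMean d n σ ω p.1 p.2) = N ω.2 := by
  have h : ∀ p : Fin d × Fin d, ∃ g : (Fin n → Sig d) × (Fin n → ℝ) → ℂ, StronglyMeasurable g ∧
      (fun ω => posteriorMean d n σ ω p.1 p.2) = g ∘ fun ω => ω.2 := fun p =>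
    StronglyMeasurable.exists_eq_measurable_comp (stronglyMeasurable_condExp)
  choose g hg hgN using h
  refine ⟨fun o => WithLp.toLp 2 fun p => g p o, ?_, fun ω => ?_⟩
  · have : Measurable fun o => (fun p => g p o : Fin d × Fin d → ℂ) :=
      measurable_pi_lambda _ fun p => (hg p).measurable
    exact (by fun_prop : Measurable fun o =>
      WithLp.toLp 2 (fun p => g p o : Fin d × Fin d → ℂ)).stronglyMeasurable
  · congr 1
    funext p
    exact congrFun (hgN p) ω

/-- The lower bound on the error, for every truncation level `ε`; the last term is the mean
overlap `E m (1 - m)⁻ⁿ` divided by `ε`. -/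
lemma one_le_mmsePR_add (hσ : 0 < σ) {p : ℕ} (hd : d = n + p + 2) {ε : ℝ} (hε : 0 < ε) :
    1 ≤ mmsePR d n σ + ε + ε⁻¹ * ((n + p + 1) / ((p + 2) * (p + 1))) := by
  have hd0 : 0 < d := by omega
  have hdr : (0 : ℝ) < (d : ℝ) ^ 2 := by positivity
  have := isProbabilityMeasure_unifSphere hd0
  obtain ⟨N, hN, hNe⟩ := exists_measurable_posteriorMean d n σ
  have h := sq_norm_le_mse_add (μ := unifSphere d) (ν := obsMeasure d n) (w := likelihood σ)
    (measurable_likelihood σ) (lintegral_likelihood_ne_top hσ hd0) (lintegral_likelihood hσ hd0)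
    (measurable_nullObsDensity σ) (lintegral_nullObsDensity hσ)
    (T := outerVec) continuous_outerVec.measurable.stronglyMeasurable (R := (d : ℝ) ^ 2)
    (by filter_upwards [ae_norm_sq_unifSphere d] with x hx; rw [norm_sq_outerVec, hx])
    hN (ENNReal.ofReal ε)
  have h1 : ∫⁻ o, ∫⁻ x, likelihood σ x o * ENNReal.ofReal (‖outerVec x - N o‖ ^ 2)
      ∂(unifSphere d) ∂(obsMeasure d n) = ENNReal.ofReal ((d : ℝ) ^ 2 * mmsePR d n σ) := by
    rw [← lintegral_frobeniusSq hσ hd0]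
    simp_rw [frobeniusSq_outer_sub, hNe]
    have hm : Measurable fun ω : Sig d × (Fin n → Sig d) × (Fin n → ℝ) =>
        ENNReal.ofReal (‖outerVec ω.1 - N ω.2‖ ^ 2) :=
      (((continuous_outerVec.measurable.comp measurable_fst).sub
        (hN.measurable.comp measurable_snd)).norm.pow_const 2).ennreal_ofReal
    rw [lintegral_jointLaw hσ hd0 hm]
  have hε0 : ENNReal.ofReal ε ≠ 0 := (ENNReal.ofReal_pos.2 hε).ne'
  have h2 : ∫⁻ o, (ENNReal.ofReal ε * nullObsDensity σ o)⁻¹ * ∫⁻ x, ∫⁻ x',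
      likelihood σ x o * likelihood σ x' o * ‖(inner ℂ (outerVec x) (outerVec x') : ℂ)‖ₑ
        ∂(unifSphere d) ∂(unifSphere d) ∂(obsMeasure d n) ≤
      ENNReal.ofReal ((d : ℝ) ^ 2 * (ε⁻¹ * ((n + p + 1) / ((p + 2) * (p + 1))))) := by
    simp_rw [enorm_inner_outerVec,
      ENNReal.mul_inv (Or.inl hε0) (Or.inl ENNReal.ofReal_ne_top), mul_assoc (ENNReal.ofReal ε)⁻¹]
    rw [lintegral_const_mul' _ _ (ENNReal.inv_ne_top.2 hε0)]
    refine (mul_le_mul_right (lintegral_replica_overlap_le hσ hd) _).trans_eq ?_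
    rw [← ENNReal.ofReal_inv_of_pos hε, ← ENNReal.ofReal_mul hdr.le,
      ← ENNReal.ofReal_mul (inv_nonneg.2 hε.le), mul_left_comm]
  rw [h1, ← ENNReal.ofReal_mul hdr.le] at h
  have h3 := h.trans (add_le_add le_rfl h2)
  have hM := mmsePR_nonneg (d := d) (n := n) (σ := σ)
  rw [← ENNReal.ofReal_add (by positivity) (by positivity),
    ← ENNReal.ofReal_add (by positivity) (by positivity),
    ENNReal.ofReal_le_ofReal_iff (by positivity), ← mul_add, ← mul_add] at h3
  exact le_of_mul_le_mul_left (by linarith) hdr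

end Error

/-! ### The limit -/

lemma tendsto_one_div_of_tendsto_ratio {δ : ℝ} {d : ℕ → ℕ}
    (hd : Tendsto (fun n : ℕ => (n : ℝ) / (d n : ℝ)) atTop (𝓝 δ)) :
    Tendsto (fun n : ℕ => 1 / (d n : ℝ)) atTop (𝓝 0) := by
  have h := hd.mul (tendsto_one_div_atTop_nhds_zero_nat (𝕜 := ℝ))
  rw [mul_zero] at h
  refine h.congr' ?_
  filter_upwards [eventually_gt_atTop 0] with n hn
  have : (n : ℝ) ≠ 0 := by positivity
  rw [div_mul_div_comm, mul_one, mul_comm (d n : ℝ), ← div_div, div_self this]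

/-- With `n / d → δ < 1`, the mean overlap of two replicas under the null model vanishes. -/
lemma tendsto_overlap_moment {δ : ℝ} (hδ1 : δ < 1) {d : ℕ → ℕ} (hd0 : ∀ᶠ n in atTop, d n ≠ 0)
    (hd : Tendsto (fun n : ℕ => (n : ℝ) / (d n : ℝ)) atTop (𝓝 δ)) :
    Tendsto (fun n : ℕ => ((d n : ℝ) - 1) / ((d n - n) * (d n - n - 1))) atTop (𝓝 0) := by
  have h1 := tendsto_one_div_of_tendsto_ratio hd
  have hc := (tendsto_const_nhds (x := (1 : ℝ)) (f := (atTop : Filter ℕ)))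
  have h := (h1.mul (hc.sub h1)).div ((hc.sub hd).mul ((hc.sub hd).sub h1))
    (by simpa using (sub_pos.2 hδ1).ne')
  simp only [zero_mul, zero_div] at h
  refine h.congr' ?_
  filter_upwards [hd0] with n hn
  have hn' : (d n : ℝ) ≠ 0 := by exact_mod_cast hn
  simp only [Pi.div_apply]
  rw [one_sub_div hn', one_sub_div hn', ← sub_div, div_mul_div_comm, div_mul_div_comm, one_mul,
    div_div_div_cancel_right₀ (mul_ne_zero hn' hn')]

lemma tendsto_mmsePR {δ : ℝ} (hδ0 : 0 < δ) (hδ1 : δ < 1) {d : ℕ → ℕ}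
    (hd : Tendsto (fun n : ℕ => (n : ℝ) / (d n : ℝ)) atTop (𝓝 δ)) {σ : ℝ} (hσ : 0 < σ) :
    Tendsto (fun n : ℕ => mmsePR (d n) n σ) atTop (𝓝 1) := by
  have hd0 : ∀ᶠ n in atTop, d n ≠ 0 := by
    filter_upwards [hd.eventually_ne hδ0.ne'] with n hn h0
    simp [h0] at hn
  have h1 := tendsto_one_div_of_tendsto_ratio hd
  have hgap : ∀ᶠ n in atTop, n + 2 ≤ d n := by
    have h2 := ((tendsto_const_nhds (x := (1 : ℝ))).sub hd).sub (h1.const_mul 2)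
    rw [mul_zero, sub_zero] at h2
    filter_upwards [h2.eventually (lt_mem_nhds (sub_pos.2 hδ1)), hd0] with n hn hn0
    have hp : (0 : ℝ) < d n := by exact_mod_cast Nat.pos_of_ne_zero hn0
    have : 0 < ((d n : ℝ) - n - 2) / d n := by
      rw [sub_div, sub_div, div_self hp.ne']
      linarith [mul_one_div (2 : ℝ) (d n : ℝ)]
    have h3 := (div_pos_iff_of_pos_right hp).1 this
    have h4 : ((n + 2 : ℕ) : ℝ) ≤ d n := by push_cast; linarith
    exact_mod_cast h4
  set r : ℕ → ℝ := fun n => ((d n : ℝ) - 1) / ((d n - n) * (d n - n - 1)) with hr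
  have hr0 : Tendsto (fun n => 1 - 2 * Real.sqrt (r n)) atTop (𝓝 1) := by
    have h := (tendsto_overlap_moment hδ1 hd0 hd).sqrt.const_mul 2
    simpa using (tendsto_const_nhds (x := (1 : ℝ))).sub h
  refine tendsto_of_tendsto_of_tendsto_of_le_of_le' hr0 tendsto_const_nhds ?_ ?_
  · filter_upwards [hgap] with n hn
    obtain ⟨p, hp⟩ := Nat.exists_eq_add_of_le hn
    have hp' : d n = n + p + 2 := by omega
    have hrn : r n = (n + p + 1) / ((p + 2) * (p + 1)) := by
      simp only [hr, hp']
      push_cast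
      congr 1 <;> ring
    have hpos : 0 < r n := by rw [hrn]; positivity
    -- the choice of `ε` that balances the two error terms
    have h := one_le_mmsePR_add hσ hp' (Real.sqrt_pos.2 hpos)
    rw [← hrn] at h
    have h5 : (Real.sqrt (r n))⁻¹ * r n = Real.sqrt (r n) := by
      rw [inv_mul_eq_div, Real.div_sqrt]
    linarith
  · filter_upwards [hd0] with n hn
    exact mmsePR_le_one hσ (Nat.pos_of_ne_zero hn)

end PhaseRetrieval

end

theorem corollary1 (δ : ℝ) (hδ0 : 0 < δ) (hδ1 : δ < 1) (d : ℕ → ℕ)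
    (hd : Tendsto (fun n : ℕ => (n : ℝ) / (d n : ℝ)) atTop (𝓝 δ)) :
    ∃ L : ℝ → ℝ,
      (∀ σ : ℝ, 0 < σ →
        Tendsto (fun n : ℕ => PhaseRetrieval.mmsePR (d n) n σ) atTop (𝓝 (L σ))) ∧
      Tendsto L (𝓝[>] 0) (𝓝 1) :=
  ⟨fun _ => 1, fun _ hσ => PhaseRetrieval.tendsto_mmsePR hδ0 hδ1 hd hσ, tendsto_const_nhds⟩
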